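/- Let $\mathcal P$ be a finite set and consider the switched linear system $\dot x=A_\sigma x+B_\sigma u$, $y=C_\sigma x$ with $x\in\mathbb R^{n}$, $u\in\mathbb R^{m}$, $y\in\mathbb R^{p}$, where $\sigma:[0,\infty)\to\mathcal P$ is right-continuous and piecewise constant. Write $N_\sigma(t,s)$ for the number of discontinuities of $\sigma$ in $(s,t]$, and say that $\sigma$ has average dwell time $\tau_a>0$ with chatter bound $N_0\ge 1$ if $N_\sigma(t,s)\le N_0+(t-s)/\tau_a$ for all $t>s\ge 0$. For every $i\in\mathcal P$ let $(A_i,B_i)$ be stabilizable and $(C_i,A_i)$ observable, and let $K_i,L_i$ be such that $A_i+B_iK_i$ and $A_i+L_iC_i$ are Hurwitz. Put $$F_i=\begin{bmatrix}A_i+B_iK_i&-B_iK_i\\0&A_i+L_iC_i\end{bmatrix},\qquad \hat L_i=\begin{bmatrix}0\\L_i\end{bmatrix},$$ and let $P_i,Q_i$ be positive definite with $F_i^\top P_i+P_iF_i=-Q_i$. Let $\overline\lambda_P=\max_i\lambda_{\max}(P_i)$, $\underline\lambda_P=\min_i\lambda_{\min}(P_i)$, $\underline\lambda_Q=\min_i\lambda_{\min}(Q_i)$,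 $C_{\max}=\max_i\|C_i\|$ and $\Theta=2\max_i\|P_i\hat L_i\|/\underline\lambda_Q$ (Euclidean induced norms). Let $q:\mathbb R^{p}\to\mathbb R^{p}$ be a quantizer with finitely many values and constants $M>\Delta>0$, $\Delta_0>0$ such that $|y|\le M\Rightarrow|q(y)-y|\le\Delta$, $|y|>M\Rightarrow|q(y)|>M-\Delta$, and $|y|\le\Delta_0\Rightarrow q(y)=0$; let $q_\mu(y)=\mu\,q(y/\mu)$ for $\mu>0$. Suppose $$M>\max\Big\{2\Delta,\ \sqrt{\overline\lambda_P/\underline\lambda_P}\;\Theta\Delta C_{\max}\Big\}.$$ The controller receives $\sigma(t)$ and $q_{\mu(t)}(y(t))$ and works in two stages. In the zooming-out stage, on $[0,T_0)$, $\xi=0$, $u=0$, and $\mu$ is a fixed positive, nondecreasing, right-continuous, piecewise constant function of time. The end $T_0$ of this stage, the value $\xi(T_0)$ and the value $\mu(T_0)>0$ are determined causally, by $\sigma$ on $[0,T_0]$ and the quantized outputs received on $[0,T_0)$. In the zooming-in stage, $t\ge T_0$, $u=K_\sigma\xi$ and $\dot\xi=(A_\sigma+L_\sigma C_\sigma)\xi+B_\sigma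 u-L_\sigma q_\mu(y)$, so that $z=(x,\,x-\xi)$ is a Filippov solution of $\dot z=F_\sigma z+\hat L_\sigma(q_\mu(y)-y)$, and, with parameters $\Omega\in(0,1)$, $T>0$ and $c_{j,i}>0$ $(i\neq j)$, $$\mu(t)=\Omega^{\lfloor (t-T_0)/T\rfloor}\sqrt{\prod_{s}c_{\sigma(s),\sigma(s^-)}}\;\mu(T_0),$$ the product running over the switching times $s\in(T_0,t]$. A strategy consists of the zooming-out function together with the three causal rules for $T_0$, $\xi(T_0)$ and $\mu(T_0)$. Say that $(\Omega,T,c)$ *stabilizes at $\tau_a$* if there is a strategy such that, for every $N_0\ge1$: * (convergence) for every $x(0)$, every $\sigma$ with average dwell time $\tau_a$ and chatter bound $N_0$, and every resulting closed-loop trajectory, $T_0$ is finite, $\mu$ is positive, right-continuous and piecewise constant, and $\lim_{t\to\infty}z(t)=0$; * (Lyapunov stability) for every $\varepsilon>0$ there is $\delta>0$ such that for all such $\sigma$ and trajectories, $|x(0)|<\delta$ implies $|z(t)|<\varepsilon$ for all $t\ge0$. Then: 1. There is $\tau_{\min}\ge0$ such that for every $\tau_a>\tau_{\min}$ some $(\Omega,T,c)$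 stabilizes at $\tau_a$. 2. Suppose $\Theta>0$. Let $\kappa>0$ satisfy $\sqrt{\underline\lambda_P}\,M>\sqrt{\overline\lambda_P}\,\Theta\Delta(1+\kappa)C_{\max}$, let $$T>\frac{\underline\lambda_PM^2-\overline\lambda_P(\Theta\Delta(1+\kappa)C_{\max})^2}{\underline\lambda_Q\,\kappa(1+\kappa)(\Theta\Delta C_{\max})^2},\qquad \Omega=\sqrt{\frac{\overline\lambda_P}{\underline\lambda_P}}\,\frac{\Theta\Delta(1+\kappa)C_{\max}}{M},$$ let $c_{j,i}>0$ satisfy $v^\top P_jv\le c_{j,i}\,v^\top P_iv$ for all $v\in\mathbb R^{2n}$ and $i\ne j$, and let $c=\max_{i\ne j}c_{j,i}$. If $$\tau_a>0\quad\text{and}\quad\tau_a>\frac{\log c}{2\log(1/\Omega)}\,T$$ (for a single mode: $\tau_a>0$), then $(\Omega,T,c)$ stabilizes at $\tau_a$. -/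

import Mathlib

open Filter Topology MeasureTheory Set
open scoped Matrix

noncomputable section

namespace QuantizedSwitching

/-! ### Linear-algebra notions -/

/-- A real square matrix is Hurwitz if all its complex eigenvalues have negative real part. -/
def IsHurwitz {n : ℕ} (A : Matrix (Fin n) (Fin n) ℝ) : Prop :=
  ∀ l ∈ spectrum ℂ (A.map (algebraMap ℝ ℂ)), l.re < 0

/-- `(A, B)` is stabilizable: some state feedback makes the closed loop Hurwitz. -/
def IsStabilizable {n m : ℕ} (A : Matrix (Fin n) (Fin n) ℝ) (B : Matrix (Fin n) (Fin m) ℝ) :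
    Prop :=
  ∃ K : Matrix (Fin m) (Fin n) ℝ, IsHurwitz (A + B * K)

/-- `(C, A)` is observable: the observability matrix `[C; CA; …; CA^(n-1)]` has trivial kernel. -/
def IsObservable {n p : ℕ} (C : Matrix (Fin p) (Fin n) ℝ) (A : Matrix (Fin n) (Fin n) ℝ) : Prop :=
  ∀ x : Fin n → ℝ, (∀ k < n, (C * A ^ k) *ᵥ x = 0) → x = 0

/-- The largest eigenvalue of a symmetric matrix. -/
def lamMax {κ : Type*} [Fintype κ] [DecidableEq κ] (A : Matrix κ κ ℝ) : ℝ := sSup (spectrum ℝ A)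

/-- The smallest eigenvalue of a symmetric matrix. -/
def lamMin {κ : Type*} [Fintype κ] [DecidableEq κ] (A : Matrix κ κ ℝ) : ℝ := sInf (spectrum ℝ A)

open scoped Matrix.Norms.L2Operator in
/-- The norm of a matrix induced by the Euclidean norms. -/
def opNorm {κ κ' : Type*} [Fintype κ] [Fintype κ'] [DecidableEq κ'] (A : Matrix κ κ' ℝ) : ℝ := ‖A‖

/-- A matrix acting on Euclidean vectors. -/
def act {κ κ' : Type*} [Fintype κ'] (A : Matrix κ κ' ℝ) (v : EuclideanSpace ℝ κ') :
    EuclideanSpace ℝ κ :=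
  WithLp.toLp 2 (A *ᵥ v.ofLp)

/-! ### Switching signals -/

/-- `f`, regarded as a function on `[0, ∞)`, is right-continuous and piecewise constant: it is
constant just to the right of every `t ≥ 0` with value `f t`, and constant just to the left of
every `t > 0`. (By compactness the jumps are then finite in number on bounded intervals.) -/
def IsPiecewiseConstant {α : Type*} (f : ℝ → α) : Prop :=
  (∀ t, 0 ≤ t → ∀ᶠ s in 𝓝[>] t, f s = f t) ∧
  (∀ t, 0 < t → ∃ a, ∀ᶠ s in 𝓝[<] t, f s = a)

/-- The switching times (discontinuities) of a signal on `[0, ∞)`. -/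
def switchTimes {ι : Type*} (σ : ℝ → ι) : Set ℝ :=
  {t | 0 < t ∧ ¬ ∀ᶠ s in 𝓝[<] t, σ s = σ t}

open scoped Classical in
/-- The mode that is active immediately before time `t`. -/
def modeBefore {ι : Type*} (σ : ℝ → ι) (t : ℝ) : ι :=
  if h : ∃ a, ∀ᶠ s in 𝓝[<] t, σ s = a then h.choose else σ t

/-- `N_σ(t, s)`: the number of switching times in `(s, t]`. -/
def numSwitches {ι : Type*} (σ : ℝ → ι) (t s : ℝ) : ℕ := (switchTimes σ ∩ Ioc s t).ncard

/-- Average dwell time `τa` with chatter bound `N₀`. -/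
def HasAverageDwellTime {ι : Type*} (σ : ℝ → ι) (τa N₀ : ℝ) : Prop :=
  ∀ s t, 0 ≤ s → s < t → (numSwitches σ t s : ℝ) ≤ N₀ + (t - s) / τa

/-! ### Quantizers -/

/-- A quantizer on `ℝ^p` with range `M` and error bound `Δ`, vanishing near the origin. -/
structure IsQuantizer {p : ℕ} (q : EuclideanSpace ℝ (Fin p) → EuclideanSpace ℝ (Fin p))
    (M Δ : ℝ) : Prop where
  finite_range : (range q).Finite
  pos : 0 < Δ
  lt : Δ < M
  error_le : ∀ y, ‖y‖ ≤ M → ‖q y - y‖ ≤ Δ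
  saturation : ∀ y, M < ‖y‖ → M - Δ < ‖q y‖
  near_zero : ∃ Δ₀ > 0, ∀ y, ‖y‖ ≤ Δ₀ → q y = 0

/-- The zoomed quantizer `q_μ(y) = μ q(y / μ)`. -/
def zoomed {p : ℕ} (q : EuclideanSpace ℝ (Fin p) → EuclideanSpace ℝ (Fin p)) (μ : ℝ)
    (y : EuclideanSpace ℝ (Fin p)) : EuclideanSpace ℝ (Fin p) :=
  μ • q (μ⁻¹ • y)

/-! ### Switched system, observer and closed loop -/

/-- The modes `(A_p, B_p, C_p)` of the plant with the gains `K_p`, `L_p`. -/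
structure SwitchedSystem (ι : Type*) (n m p : ℕ) where
  A : ι → Matrix (Fin n) (Fin n) ℝ
  B : ι → Matrix (Fin n) (Fin m) ℝ
  C : ι → Matrix (Fin p) (Fin n) ℝ
  K : ι → Matrix (Fin m) (Fin n) ℝ
  L : ι → Matrix (Fin n) (Fin p) ℝ

/-- The space of `z = (x, x - ξ)`. -/
abbrev ZSpace (n : ℕ) := EuclideanSpace ℝ (Fin n ⊕ Fin n)

/-- The plant state `x` contained in `z = (x, x - ξ)`. -/
def stateOf {n : ℕ} (z : ZSpace n) : EuclideanSpace ℝ (Fin n) :=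
  WithLp.toLp 2 fun i => z (Sum.inl i)

/-- The observer state `ξ` contained in `z = (x, x - ξ)`. -/
def observerOf {n : ℕ} (z : ZSpace n) : EuclideanSpace ℝ (Fin n) :=
  WithLp.toLp 2 fun i => z (Sum.inl i) - z (Sum.inr i)

namespace SwitchedSystem

variable {ι : Type*} {n m p : ℕ} (sys : SwitchedSystem ι n m p)

/-- The closed-loop matrix `F_i`. -/
def F (i : ι) : Matrix (Fin n ⊕ Fin n) (Fin n ⊕ Fin n) ℝ :=
  Matrix.fromBlocks (sys.A i + sys.B i * sys.K i) (-(sys.B i * sys.K i))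
    0 (sys.A i + sys.L i * sys.C i)

/-- `L̂_i = [0; L_i]`. -/
def Lhat (i : ι) : Matrix (Fin n ⊕ Fin n) (Fin p) ℝ := Matrix.fromRows 0 (sys.L i)

/-- The output `y = C_i x` as a function of `z`. -/
def output (i : ι) (z : ZSpace n) : EuclideanSpace ℝ (Fin p) := act (sys.C i) (stateOf z)

/-- The right-hand side `F_i z + L̂_i (q_μ(y) - y)` of the closed loop. -/
def field (q : EuclideanSpace ℝ (Fin p) → EuclideanSpace ℝ (Fin p)) (i : ι) (μ : ℝ)
    (z : ZSpace n) : ZSpace n :=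
  act (sys.F i) z + act (sys.Lhat i) (zoomed q μ (sys.output i z) - sys.output i z)

/-- `C_max`. -/
def Cmax : ℝ := ⨆ i, opNorm (sys.C i)

/-- `Θ = 2 max ‖P_i L̂_i‖ / min λ_min(Q_i)`. -/
def Theta (P Q : ι → Matrix (Fin n ⊕ Fin n) (Fin n ⊕ Fin n) ℝ) : ℝ :=
  2 * (⨆ i, opNorm (P i * sys.Lhat i)) / ⨅ i, lamMin (Q i)

end SwitchedSystem

/-- Filippov's regularization of a vector field: limits of convex combinations of nearby values,
disregarding sets of Lebesgue measure zero. -/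
def filippov {κ : Type*} [Fintype κ] (f : EuclideanSpace ℝ κ → EuclideanSpace ℝ κ)
    (z : EuclideanSpace ℝ κ) : Set (EuclideanSpace ℝ κ) :=
  ⋂ (δ : ℝ) (_ : 0 < δ) (N : Set (EuclideanSpace ℝ κ)) (_ : volume N = 0),
    closure (convexHull ℝ (f '' (Metric.ball z δ \ N)))

/-- `z` is, on the interval `I` with left end point `a`, an absolutely continuous solution of
the differential inclusion `ż ∈ G t z`: it is the integral of a locally integrable function that
lies in `G t (z t)` for almost every `t`. -/
def IsSolutionOn {κ : Type*} [Fintype κ] (G : ℝ → EuclideanSpace ℝ κ → Set (EuclideanSpace ℝ κ))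
    (a : ℝ) (I : Set ℝ) (z : ℝ → EuclideanSpace ℝ κ) : Prop :=
  ∃ g : ℝ → EuclideanSpace ℝ κ,
    (∀ t ∈ I, IntervalIntegrable g volume a t ∧ z t = z a + ∫ s in a..t, g s) ∧
    (∀ᵐ t, t ∈ I → g t ∈ G t (z t))

/-- The zoom parameter of the zooming-in stage that starts at time `T₀` with value `μ₀`: it is
multiplied by `Ω` at `T₀ + T, T₀ + 2T, …`, and by `√c_{p₂,p₁}` at every switch from
mode `p₁` to mode `p₂`. -/
def zoomIn {ι : Type*} (Ω T : ℝ) (c : ι → ι → ℝ) (σ : ℝ → ι) (T₀ μ₀ t : ℝ) : ℝ :=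
  Ω ^ ⌊(t - T₀) / T⌋₊ *
    √(∏ᶠ s ∈ switchTimes σ ∩ Ioc T₀ t, c (σ s) (modeBefore σ s)) * μ₀

/-- What has to be chosen in order to run the encoder and controller: the zoom parameter `out` of
the zooming-out stage, a function of time only; the time `endTime` at which that stage ends (`⊤` if
never); and the observer state `est` and the zoom parameter `init` with which the zooming-in stage
then starts. The last three are functions of the switching signal `σ` and the received quantized
output `w`, and `causal` says that they use only what has been received by the time `endTime`. -/
structure ZoomStrategy (ι : Type*) (n p : ℕ) where
  out : ℝ → ℝ
  out_pos : ∀ t, 0 ≤ t → 0 < out t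
  out_mono : MonotoneOn out (Ici 0)
  out_piecewise : IsPiecewiseConstant out
  endTime : (ℝ → ι) → (ℝ → EuclideanSpace ℝ (Fin p)) → WithTop ℝ
  est : (ℝ → ι) → (ℝ → EuclideanSpace ℝ (Fin p)) → EuclideanSpace ℝ (Fin n)
  init : (ℝ → ι) → (ℝ → EuclideanSpace ℝ (Fin p)) → ℝ
  endTime_nonneg : ∀ σ w, 0 ≤ endTime σ w
  init_pos : ∀ σ w, 0 < init σ w
  causal : ∀ (σ σ' : ℝ → ι) (w w' : ℝ → EuclideanSpace ℝ (Fin p)) (t : ℝ),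
    endTime σ w = t → (∀ s ∈ Icc 0 t, σ s = σ' s) → (∀ s ∈ Ico 0 t, w s = w' s) →
    endTime σ' w' = t ∧ est σ' w' = est σ w ∧ init σ' w' = init σ w

section Run

variable {ι : Type*} {n m p : ℕ}

/-- The quantized output `q_{μ(t)}(y(t))` received by the controller. -/
def received (sys : SwitchedSystem ι n m p)
    (q : EuclideanSpace ℝ (Fin p) → EuclideanSpace ℝ (Fin p)) (σ : ℝ → ι)
    (z : ℝ → ZSpace n) (μ : ℝ → ℝ) (t : ℝ) : EuclideanSpace ℝ (Fin p) :=
  zoomed q (μ t) (sys.output (σ t) (z t))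

/-- `(z, μ)` is a run of the closed loop under the strategy `S` and the switching signal `σ`.
Until `endTime`, `u = 0` and `ξ = 0`, so that `ẋ = A_σ x`. At `endTime` the observer state is set to
`est`, and from then on `z` is a Filippov solution of `ż = F_σ z + L̂_σ (q_μ(y) - y)`. -/
structure IsRun (sys : SwitchedSystem ι n m p)
    (q : EuclideanSpace ℝ (Fin p) → EuclideanSpace ℝ (Fin p)) (S : ZoomStrategy ι n p)
    (Ω T : ℝ) (c : ι → ι → ℝ) (σ : ℝ → ι) (z : ℝ → ZSpace n) (μ : ℝ → ℝ) : Prop where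
  zoom_out : ∀ t : ℝ, 0 ≤ t → (t : WithTop ℝ) < S.endTime σ (received sys q σ z μ) → μ t = S.out t
  observer_out : ∀ t : ℝ, 0 ≤ t → (t : WithTop ℝ) < S.endTime σ (received sys q σ z μ) →
    observerOf (z t) = 0
  state_out : IsSolutionOn (fun t x => {act (sys.A (σ t)) x}) 0
    {t : ℝ | 0 ≤ t ∧ (t : WithTop ℝ) ≤ S.endTime σ (received sys q σ z μ)} (fun t => stateOf (z t))
  zoom_in : ∀ T₀ : ℝ, S.endTime σ (received sys q σ z μ) = T₀ → ∀ t, T₀ ≤ t →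
    μ t = zoomIn Ω T c σ T₀ (S.init σ (received sys q σ z μ)) t
  observer_reset : ∀ T₀ : ℝ, S.endTime σ (received sys q σ z μ) = T₀ →
    observerOf (z T₀) = S.est σ (received sys q σ z μ)
  state_in : ∀ T₀ : ℝ, S.endTime σ (received sys q σ z μ) = T₀ →
    IsSolutionOn (fun t => filippov (sys.field q (σ t) (μ t))) T₀ (Ici T₀) z

/-- With the zooming-in parameters `Ω`, `T`, `c`, some strategy makes the closed loop globally
asymptotically stable for all switching signals with average dwell time `τa`. The strategy does
not depend on the chatter bound, the switching signal or the initial state, and `δ` does not depend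
on the switching signal. -/
def Stabilizes (sys : SwitchedSystem ι n m p)
    (q : EuclideanSpace ℝ (Fin p) → EuclideanSpace ℝ (Fin p))
    (Ω T : ℝ) (c : ι → ι → ℝ) (τa : ℝ) : Prop :=
  ∃ S : ZoomStrategy ι n p, ∀ N₀ : ℝ, 1 ≤ N₀ →
    (∀ (σ : ℝ → ι) (z : ℝ → ZSpace n) (μ : ℝ → ℝ),
      IsPiecewiseConstant σ → HasAverageDwellTime σ τa N₀ → IsRun sys q S Ω T c σ z μ →
        (∃ T₀ : ℝ, S.endTime σ (received sys q σ z μ) = T₀) ∧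
        IsPiecewiseConstant μ ∧ (∀ t, 0 ≤ t → 0 < μ t) ∧
        Tendsto z atTop (𝓝 0)) ∧
    (∀ ε > 0, ∃ δ > 0, ∀ (σ : ℝ → ι) (z : ℝ → ZSpace n) (μ : ℝ → ℝ),
      IsPiecewiseConstant σ → HasAverageDwellTime σ τa N₀ → IsRun sys q S Ω T c σ z μ →
        ‖stateOf (z 0)‖ < δ → ∀ t, 0 ≤ t → ‖z t‖ < ε)

end Run

end QuantizedSwitching

end

noncomputable section

namespace QuantizedSwitching

/-! ### Real analysis -/

/-! Zooming in. Compare V = zᵀP_σz with μ². As long as the quantizer does not saturate, its error is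
at most Δμ, and V decreases at a rate proportional to μ² wherever ‖z‖ ≥ ΘΔ(1+κ)μ
(`LyapunovBounds.decay`). The inequality V ≤ rμ² itself excludes saturation. Over one period T the
ratio V/μ² falls from r to r₂ = λ̄_P(ΘΔ(1+κ))² = rΩ², and multiplying μ by Ω then restores the level
r. A switch from i to j multiplies V by at most c_{j,i} and μ² by exactly c_{j,i}, so it does not
raise the ratio. Hence V ≤ rμ² for all later times (`LyapunovBounds.zoomIn_invariant`). The average
dwell time makes μ decay exponentially (`zoomIn_le`): the gain log(1/Ω)/T per unit time exceeds the
cost log c/(2τa) of switching. Excluding saturation on a closed sublevel set needs a strict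
inequality, which is obtained by decreasing κ slightly at fixed Ω (`exists_strict_margin`).

Zooming out. The gain outgrows x, so the output eventually looks unsaturated. Among boundedly many
consecutive intervals of length τa/2 one contains no switch
(`HasAverageDwellTime.exists_no_switch`). On an unsaturated interval with constant mode,
observability bounds x by the output, hence by μ (`IsObservable.exists_norm_le`). Only this bound is
needed: the observer may start at ξ = 0 with μ(T₀) a fixed multiple of the last gain.

Lyapunov stability. A small x(0) bounds T₀ uniformly. From some uniform time s after T₀ on, the
exponential estimate gives ‖z‖ < ε. Up to then Grönwall's inequality suffices, because the quantizer
vanishes near 0 and the vector field is therefore bounded by K‖z‖ uniformly in μ.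

Filippov solutions enter only through upper bounds for convex functions of the velocity, which pass
to the regularization (`le_of_mem_filippov`). -/

/-- Induction along a half-line. -/
theorem forall_ge_of_left_of_right {a : ℝ} {p : ℝ → Prop} (ha : p a)
    (hleft : ∀ t, a < t → (∀ s ∈ Ico a t, p s) → p t)
    (hright : ∀ t, a ≤ t → p t → ∀ᶠ s in 𝓝[>] t, p s) : ∀ t, a ≤ t → p t := by
  by_contra! hcon
  obtain ⟨t₀, hat₀, hpt₀⟩ := hcon
  -- The infimum of the counterexamples satisfies p by `hleft`, and then `hright` keeps
  -- counterexamples away from it.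
  set S : Set ℝ := {t | a ≤ t ∧ ¬ p t}
  have hne : S.Nonempty := ⟨t₀, hat₀, hpt₀⟩
  have hbdd : BddBelow S := ⟨a, fun t ht => ht.1⟩
  have hai : a ≤ sInf S := le_csInf hne fun t ht => ht.1
  have hlt : ∀ s ∈ Ico a (sInf S), p s := fun s hs => by
    by_contra hps
    exact absurd (csInf_le hbdd (show s ∈ S from ⟨hs.1, hps⟩)) (not_le.2 hs.2)
  have hpi : p (sInf S) := by
    rcases hai.eq_or_lt with h | h
    · exact h ▸ ha
    · exact hleft _ h hlt
  obtain ⟨u, hu, hsub⟩ := mem_nhdsGT_iff_exists_Ioo_subset.1 (hright _ hai hpi)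
  obtain ⟨t, ht, htu⟩ := exists_lt_of_csInf_lt hne (show sInf S < u from hu)
  rcases (csInf_le hbdd ht).eq_or_lt with h | h
  · exact ht.2 (h ▸ hpi)
  · exact ht.2 (hsub ⟨h, htu⟩)

/-! ### Absolutely continuous functions as integrals -/

section Primitive

variable {E : Type*} [NormedAddCommGroup E] [NormedSpace ℝ E]

/-- `z` is a primitive of `g` on `[a, b]`. -/
def IsPrimitiveOn (z g : ℝ → E) (a b : ℝ) : Prop :=
  ∀ t ∈ Icc a b, IntervalIntegrable g volume a t ∧ z t = z a + ∫ s in a..t, g s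

theorem IsPrimitiveOn.intervalIntegrable {z g : ℝ → E} {a b s t : ℝ} (h : IsPrimitiveOn z g a b)
    (hs : s ∈ Icc a b) (ht : t ∈ Icc a b) : IntervalIntegrable g volume s t :=
  (h s hs).1.symm.trans (h t ht).1

theorem IsPrimitiveOn.sub_eq {z g : ℝ → E} {a b s t : ℝ} (h : IsPrimitiveOn z g a b)
    (hs : s ∈ Icc a b) (ht : t ∈ Icc a b) : z t - z s = ∫ r in s..t, g r := by
  rw [(h s hs).2, (h t ht).2, add_sub_add_left_eq_sub,
    intervalIntegral.integral_interval_sub_left (h t ht).1 (h s hs).1]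

theorem IsPrimitiveOn.mono {z g : ℝ → E} {a b s t : ℝ} (h : IsPrimitiveOn z g a b)
    (hs : a ≤ s) (ht : t ≤ b) : IsPrimitiveOn z g s t := fun r hr =>
  have hs' : s ∈ Icc a b := ⟨hs, hr.1.trans (hr.2.trans ht)⟩
  have hr' : r ∈ Icc a b := ⟨hs.trans hr.1, hr.2.trans ht⟩
  ⟨h.intervalIntegrable hs' hr', by rw [← h.sub_eq hs' hr']; abel⟩

theorem IsPrimitiveOn.continuousOn {z g : ℝ → E} {a b : ℝ} (h : IsPrimitiveOn z g a b) :
    ContinuousOn z (Icc a b) := by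
  rcases lt_or_ge b a with hab | hab
  · simp [Icc_eq_empty_of_lt hab]
  have hgi : IntervalIntegrable g volume a b := (h b (right_mem_Icc.2 hab)).1
  have hc : ContinuousOn (fun t => z a + ∫ s in a..t, g s) (Icc a b) := by
    refine continuousOn_const.add ?_
    have := intervalIntegral.continuousOn_primitive_interval
      ((intervalIntegrable_iff_integrableOn_Icc_of_le hab).1 hgi |>.mono_set
        (by rw [uIcc_of_le hab]))
    rwa [uIcc_of_le hab] at this
  exact hc.congr fun t ht => (h t ht).2

/-- Grönwall's inequality for primitives. -/
theorem IsPrimitiveOn.norm_le {z g : ℝ → E} {a b K : ℝ} (h : IsPrimitiveOn z g a b) (hK : 0 ≤ K)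
    (hg : ∀ᵐ t, t ∈ Icc a b → ‖g t‖ ≤ K * ‖z t‖) {t : ℝ} (ht : t ∈ Icc a b) :
    ‖z t‖ ≤ ‖z a‖ * Real.exp (K * (t - a)) := by
  have hab : a ≤ b := ht.1.trans ht.2
  -- Extending z continuously to the line makes ψ below differentiable everywhere. Grönwall's
  -- inequality is applied to this majorant ψ, since z itself need not have one-sided derivatives.
  set y : ℝ → E := fun t => z (projIcc a b hab t)
  have hy : Continuous y :=
    (continuousOn_iff_continuous_domRestrict.1 h.continuousOn).comp continuous_projIcc
  have hyz : ∀ t ∈ Icc a b, y t = z t := fun t ht => by simp only [y, projIcc_of_mem hab ht]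
  set ψ : ℝ → ℝ := fun t => ‖z a‖ + ∫ s in a..t, K * ‖y s‖
  have hc : Continuous fun s => K * ‖y s‖ := continuous_const.mul hy.norm
  have hψ : ∀ t, HasDerivAt ψ (K * ‖y t‖) t := fun t =>
    (hc.integral_hasStrictDerivAt a t).hasDerivAt.const_add _
  have hle : ∀ t ∈ Icc a b, ‖z t‖ ≤ ψ t := fun t ht => by
    rw [(h t ht).2]
    refine (norm_add_le _ _).trans (add_le_add_right ?_ _)
    refine intervalIntegral.norm_integral_le_of_norm_le ht.1 ?_ (hc.intervalIntegrable _ _)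
    filter_upwards [hg] with s hs hst
    have hs' : s ∈ Icc a b := ⟨hst.1.le, hst.2.trans ht.2⟩
    rw [hyz s hs']
    exact hs hs'
  have hψ0 : ∀ t ∈ Icc a b, 0 ≤ ψ t := fun t ht => (norm_nonneg _).trans (hle t ht)
  have := norm_le_gronwallBound_of_norm_deriv_right_le (f := ψ) (f' := fun t => K * ‖y t‖)
    (δ := ‖z a‖) (K := K) (ε := 0) (a := a) (b := b)
    (fun t _ => (hψ t).continuousAt.continuousWithinAt) (fun t _ => (hψ t).hasDerivWithinAt)
    (by simp [ψ]) (fun t ht => by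
      have ht' : t ∈ Icc a b := Ico_subset_Icc_self ht
      rw [Real.norm_of_nonneg (by positivity), Real.norm_of_nonneg (hψ0 t ht'), add_zero, hyz t ht']
      exact mul_le_mul_of_nonneg_left (hle t ht') hK) t ht
  rw [gronwallBound_ε0, Real.norm_of_nonneg (hψ0 t ht)] at this
  exact (hle t ht).trans this

end Primitive

/-- A continuous function whose increments are bounded above by a multiple of the squared length
does not increase. -/
theorem le_of_sub_le_mul_sq {φ : ℝ → ℝ} {a b C : ℝ} (hab : a ≤ b) (hc : ContinuousOn φ (Icc a b))
    (h : ∀ s ∈ Icc a b, ∀ t ∈ Icc a b, s ≤ t → φ t - φ s ≤ C * (t - s) ^ 2) : φ b ≤ φ a := by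
  refine image_le_of_liminf_slope_right_le_deriv_boundary (B := fun _ => φ a) (B' := fun _ => 0)
    hc le_rfl continuousOn_const (fun x _ => hasDerivWithinAt_const _ _ _) ?_ (right_mem_Icc.2 hab)
  intro x hx r hr
  have h1 : ∀ᶠ t in 𝓝[>] x, t ∈ Ioo x b := Ioo_mem_nhdsGT hx.2
  have h2 : ∀ᶠ t in 𝓝[>] x, C * (t - x) < r := by
    have : Tendsto (fun t => C * (t - x)) (𝓝[>] x) (𝓝 (C * (x - x))) :=
      ((continuous_const.mul (continuous_id.sub continuous_const)).tendsto x).mono_left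
        nhdsWithin_le_nhds
    exact this.eventually_lt_const (by simpa using hr)
  refine (h1.and h2).frequently.mono ?_
  rintro t ⟨ht, ht'⟩
  have hpos : 0 < t - x := sub_pos.2 ht.1
  rw [slope_def_field, div_lt_iff₀ hpos]
  have := h x (Ico_subset_Icc_self hx) t ⟨hx.1.trans ht.1.le, ht.2.le⟩ ht.1.le
  nlinarith

/-! ### Quadratic forms along absolutely continuous curves -/

section Quadratic

variable {E : Type*} [NormedAddCommGroup E] [InnerProductSpace ℝ E] [CompleteSpace E]

/-- A quadratic form decreases at rate at least `ρ` along a primitive with bounded integrand, if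
its formal derivative is at most `-ρ` almost everywhere. -/
theorem IsPrimitiveOn.quadratic_le {z g : ℝ → E} {a b B ρ : ℝ} (h : IsPrimitiveOn z g a b)
    (hab : a ≤ b) (P : E →L[ℝ] E) (hP : ∀ x y, inner ℝ (P x) y = inner ℝ x (P y))
    (hB : ∀ᵐ t, t ∈ Icc a b → ‖g t‖ ≤ B)
    (hg : ∀ᵐ t, t ∈ Icc a b → 2 * inner ℝ (P (z t)) (g t) ≤ -ρ) :
    inner ℝ (P (z b)) (z b) ≤ inner ℝ (P (z a)) (z a) - ρ * (b - a) := by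
  rcases hab.eq_or_lt with rfl | hlt
  · simp
  -- A negative B would make the almost everywhere bound fail on an interval of positive measure.
  have hB0 : 0 ≤ B := by
    by_contra hneg
    have : ∀ᵐ t : ℝ, t ∉ Icc a b := by
      filter_upwards [hB] with t ht hmem
      exact hneg ((norm_nonneg _).trans (ht hmem))
    have h0 : volume (Icc a b) = 0 := by
      rw [ae_iff] at this
      simpa only [not_not, ofPred_mem_eq] using this
    rw [Real.volume_Icc] at h0
    simp only [ENNReal.ofReal_eq_zero] at h0
    linarith
  have hLip : ∀ s ∈ Icc a b, ∀ t ∈ Icc a b, s ≤ t → ‖z t - z s‖ ≤ B * (t - s) := by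
    intro s hs t ht hst
    rw [h.sub_eq hs ht]
    have := intervalIntegral.norm_integral_le_of_norm_le hst (f := g) (g := fun _ => B)
      (μ := volume) (by
        filter_upwards [hB] with r hr hrm
        exact hr ⟨hs.1.trans hrm.1.le, hrm.2.trans ht.2⟩) (by simp)
    simpa [mul_comm] using this
  have hcont := h.continuousOn
  -- Instead of differentiating the form, its increments are estimated: replacing P(z s) + P(z t) by
  -- 2P(z r) under the integral costs O(t − s) pointwise, so the increment of the form plus ρt is at
  -- most C(t − s)².
  have key := le_of_sub_le_mul_sq (φ := fun t => inner ℝ (P (z t)) (z t) + ρ * t)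
    (C := 2 * ‖P‖ * B ^ 2) hab (((P.continuous.comp_continuousOn hcont).inner hcont).add
      (by fun_prop)) ?_
  · linarith
  intro s hs t ht hst
  have hexp : inner ℝ (P (z t)) (z t) - inner ℝ (P (z s)) (z s) =
      inner ℝ (P (z t) + P (z s)) (z t - z s) := by
    simp only [inner_add_left, inner_sub_right]
    have h2 : inner ℝ (P (z s)) (z t) = inner ℝ (P (z t)) (z s) := by
      rw [hP, real_inner_comm]
    linarith
  have hgi := h.intervalIntegrable hs ht
  have hsub := h.sub_eq hs ht
  have hI : inner ℝ (P (z t) + P (z s)) (z t - z s) =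
      ∫ r in s..t, inner ℝ (P (z t) + P (z s)) (g r) := by
    rw [hsub]
    exact ((innerSL ℝ (P (z t) + P (z s))).intervalIntegral_comp_comm hgi).symm
  have hbound : ∫ r in s..t, inner ℝ (P (z t) + P (z s)) (g r) ≤
      ∫ r in s..t, (-ρ + 2 * ‖P‖ * B ^ 2 * (t - s)) := by
    refine intervalIntegral.integral_mono_ae_restrict hst
      ((intervalIntegrable_iff_integrableOn_Ioc_of_le hst).2
        ((innerSL ℝ (P (z t) + P (z s))).integrable_comp
          ((intervalIntegrable_iff_integrableOn_Ioc_of_le hst).1 hgi))) (by simp) ?_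
    rw [EventuallyLE, ae_restrict_iff' measurableSet_Icc]
    filter_upwards [hB, hg] with r hBr hgr hr
    have hr' : r ∈ Icc a b := ⟨hs.1.trans hr.1, hr.2.trans ht.2⟩
    have e1 : inner ℝ (P (z t) + P (z s)) (g r) = 2 * inner ℝ (P (z r)) (g r) +
        inner ℝ (P (z t - z r)) (g r) - inner ℝ (P (z r - z s)) (g r) := by
      simp only [map_sub, inner_add_left, inner_sub_left]; ring
    have e2 : ∀ w : E, ‖w‖ ≤ B * (t - s) → |inner ℝ (P w) (g r)| ≤ ‖P‖ * B ^ 2 * (t - s) := by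
      intro w hw
      have hts : 0 ≤ t - s := sub_nonneg.2 hst
      calc |inner ℝ (P w) (g r)| ≤ ‖P w‖ * ‖g r‖ := abs_real_inner_le_norm _ _
        _ ≤ (‖P‖ * (B * (t - s))) * B := by
            refine mul_le_mul ((P.le_opNorm w).trans ?_) (hBr hr') (norm_nonneg _) (by positivity)
            gcongr
        _ = _ := by ring
    have e3 := (abs_le.1 (e2 (z t - z r) ((hLip r hr' t ht hr.2).trans
      (mul_le_mul_of_nonneg_left (by linarith [hr.1]) hB0)))).2
    have e4 := (abs_le.1 (e2 (z r - z s) ((hLip s hs r hr' hr.1).trans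
      (mul_le_mul_of_nonneg_left (by linarith [hr.2]) hB0)))).1
    have e5 := hgr hr'
    rw [e1]
    linarith
  rw [intervalIntegral.integral_const, smul_eq_mul] at hbound
  have : inner ℝ (P (z t)) (z t) - inner ℝ (P (z s)) (z s) ≤
      (t - s) * (-ρ + 2 * ‖P‖ * B ^ 2 * (t - s)) := by rw [hexp, hI]; exact hbound
  nlinarith

end Quadratic

/-! ### Switching signals and zoom parameters -/

section Switching

variable {ι : Type*} {σ : ℝ → ι}

theorem IsPiecewiseConstant.eventually_left (hσ : IsPiecewiseConstant σ) {t : ℝ} (ht : 0 < t) :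
    ∀ᶠ s in 𝓝[<] t, σ s = modeBefore σ t := by
  have h := hσ.2 t ht
  rw [modeBefore, dif_pos h]
  exact h.choose_spec

theorem IsPiecewiseConstant.modeBefore_eq (hσ : IsPiecewiseConstant σ) {t : ℝ} (ht : 0 < t)
    (h : t ∉ switchTimes σ) : modeBefore σ t = σ t := by
  have h' : ∀ᶠ s in 𝓝[<] t, σ s = σ t := by
    by_contra hcon
    exact h ⟨ht, hcon⟩
  obtain ⟨s, h1, h2⟩ := ((hσ.eventually_left ht).and h').exists
  exact h1.symm.trans h2

theorem IsPiecewiseConstant.modeBefore_ne (hσ : IsPiecewiseConstant σ) {t : ℝ}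
    (h : t ∈ switchTimes σ) : modeBefore σ t ≠ σ t := fun heq =>
  h.2 (heq ▸ hσ.eventually_left h.1)

theorem notMem_switchTimes_of_eqOn_Ioo {a : ι} {u v s : ℝ} (h : ∀ r ∈ Ioo u v, σ r = a)
    (hs : s ∈ Ioo u v) : s ∉ switchTimes σ := fun hmem => hmem.2 <| by
  filter_upwards [Ioo_mem_nhdsLT hs.1] with r hr
  rw [h r ⟨hr.1, hr.2.trans hs.2⟩, h s hs]

theorem IsPiecewiseConstant.eventually_right_notMem (hσ : IsPiecewiseConstant σ) {t : ℝ}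
    (ht : 0 ≤ t) : ∀ᶠ s in 𝓝[>] t, ∀ r ∈ Ioc t s, r ∉ switchTimes σ := by
  obtain ⟨u, hu, hsub⟩ := mem_nhdsGT_iff_exists_Ioo_subset.1 (hσ.1 t ht)
  filter_upwards [Ioo_mem_nhdsGT hu] with s hs r hr
  exact notMem_switchTimes_of_eqOn_Ioo (fun r hr => hsub hr) ⟨hr.1, hr.2.trans_lt hs.2⟩

theorem IsPiecewiseConstant.eventually_left_notMem (hσ : IsPiecewiseConstant σ) {t : ℝ}
    (ht : 0 < t) : ∀ᶠ s in 𝓝[<] t, ∀ r ∈ Ioo s t, r ∉ switchTimes σ := by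
  obtain ⟨u, hu, hsub⟩ := mem_nhdsLT_iff_exists_Ioo_subset.1 (hσ.eventually_left ht)
  filter_upwards [Ioo_mem_nhdsLT hu] with s hs r hr
  exact notMem_switchTimes_of_eqOn_Ioo (fun r hr => hsub hr) ⟨hs.1.trans hr.1, hr.2⟩

/-- Every point of a compact interval has a neighbourhood in which it is the only possible switching
time; compactness does the rest. -/
theorem IsPiecewiseConstant.finite_switchTimes (hσ : IsPiecewiseConstant σ) (s t : ℝ) :
    (switchTimes σ ∩ Ioc s t).Finite := by
  suffices h : (switchTimes σ ∩ Icc 0 t).Finite from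
    h.subset fun r hr => ⟨hr.1, hr.1.1.le, hr.2.2⟩
  refine isCompact_Icc.induction_on (p := fun K => (switchTimes σ ∩ K).Finite) (by simp)
    (fun K K' hKK' h => h.subset (inter_subset_inter_right _ hKK'))
    (fun K K' h h' => by rw [inter_union_distrib_left]; exact h.union h') ?_
  intro x hx
  obtain ⟨v, hv, hvr⟩ : ∃ v, x < v ∧ ∀ r ∈ Ioo x v, r ∉ switchTimes σ := by
    obtain ⟨v, h, hv⟩ :=
      ((hσ.eventually_right_notMem hx.1).and (self_mem_nhdsWithin (s := Ioi x))).exists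
    exact ⟨v, hv, fun r hr => h r ⟨hr.1, hr.2.le⟩⟩
  obtain ⟨u, hu, hur⟩ : ∃ u, u < x ∧ ∀ r ∈ Ioo u x, r ∉ switchTimes σ := by
    rcases hx.1.eq_or_lt with h0 | h0
    · exact ⟨x - 1, by linarith, fun r hr hmem => by
        have := hmem.1
        have := hr.2
        linarith⟩
    · obtain ⟨u, h, hu⟩ :=
        ((hσ.eventually_left_notMem h0).and (self_mem_nhdsWithin (s := Iio x))).exists
      exact ⟨u, hu, h⟩
  refine ⟨Ioo u v, mem_nhdsWithin_of_mem_nhds (Ioo_mem_nhds hu hv), ?_⟩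
  refine (finite_singleton x).subset ?_
  rintro r ⟨hr, hr'⟩
  rcases lt_trichotomy r x with h | h | h
  · exact absurd hr (hur r ⟨hr'.1, h⟩)
  · exact h
  · exact absurd hr (hvr r ⟨h, hr'.2⟩)

/-- A signal without switching times on an interval is constant there. -/
theorem IsPiecewiseConstant.eq_of_no_switch (hσ : IsPiecewiseConstant σ) {a b : ℝ} (ha : 0 ≤ a)
    (h : ∀ r ∈ Ioc a b, r ∉ switchTimes σ) : ∀ s ∈ Icc a b, σ s = σ a := by
  have key : ∀ s, a ≤ s → (s ≤ b → σ s = σ a) := by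
    refine forall_ge_of_left_of_right (fun _ => rfl) ?_ ?_
    · intro t hat ih htb
      have h0 : 0 < t := ha.trans_lt hat
      obtain ⟨s, hs, hs'⟩ := ((hσ.eventually_left h0).and (Ioo_mem_nhdsLT hat)).exists
      rw [← hσ.modeBefore_eq h0 (h t ⟨hat, htb⟩), ← hs]
      exact ih s ⟨hs'.1.le, hs'.2⟩ (hs'.2.le.trans htb)
    · intro t hat ih
      filter_upwards [hσ.1 t (ha.trans hat), self_mem_nhdsWithin] with s hs hts hsb
      rw [hs, ih ((le_of_lt hts).trans hsb)]
  exact fun s hs => key s hs.1 hs.2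

/-- Under an average dwell time `τa`, among sufficiently many consecutive intervals of
length `τa / 2` one is free of switches. -/
theorem HasAverageDwellTime.exists_no_switch {τa N₀ : ℝ} (hσ : IsPiecewiseConstant σ)
    (h : HasAverageDwellTime σ τa N₀) (hτa : 0 < τa) (K m : ℕ) (hm : 2 * N₀ < m) (hm0 : 0 < m) :
    ∃ k, K ≤ k ∧ k < K + m ∧
      ∀ r ∈ Ioc ((k : ℝ) * (τa / 2)) ((k + 1) * (τa / 2)), r ∉ switchTimes σ := by
  -- Pigeonhole: a switch in each of m consecutive intervals would give m switches within time
  -- mτa/2, so m ≤ N₀ + m/2, contrary to 2N₀ < m. The intervals are half-open, hence disjoint.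
  by_contra! hcon
  choose! r hr hrs using fun j : ℕ => hcon (K + j) (Nat.le_add_right _ _)
  have hτ : 0 < τa / 2 := by positivity
  have hN := h (K * (τa / 2)) ((K + m : ℕ) * (τa / 2)) (by positivity) (by
    push_cast
    have : (0 : ℝ) < m := by exact_mod_cast hm0
    nlinarith)
  have hcard : m ≤ numSwitches σ ((K + m : ℕ) * (τa / 2)) (K * (τa / 2)) := by
    have hsub : r '' (Finset.range m : Set ℕ) ⊆
        switchTimes σ ∩ Ioc ((K : ℝ) * (τa / 2)) ((K + m : ℕ) * (τa / 2)) := by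
      rintro _ ⟨j, hj, rfl⟩
      have hj' : j < m := by simpa using hj
      have hmem := hr j (by omega)
      refine ⟨hrs j (by omega), lt_of_le_of_lt ?_ hmem.1, hmem.2.trans ?_⟩
      · gcongr; simp
      · gcongr
        have : j + 1 ≤ m := hj'
        push_cast
        have : (j : ℝ) + 1 ≤ m := by exact_mod_cast this
        linarith
    have hinj : InjOn r (Finset.range m : Set ℕ) := by
      have hlt : ∀ i j : ℕ, i < m → j < m → i < j → r i < r j := by
        intro i j hi hj hij
        have h1 := (hr i (by omega)).2
        have h2 := (hr j (by omega)).1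
        refine h1.trans_lt (lt_of_le_of_lt ?_ h2)
        gcongr
        have : (i : ℝ) + 1 ≤ j := by exact_mod_cast hij
        push_cast
        linarith
      intro i hi j hj hij
      have hi' : i < m := by simpa using hi
      have hj' : j < m := by simpa using hj
      rcases lt_trichotomy i j with h | h | h
      · exact absurd hij (hlt i j hi' hj' h).ne
      · exact h
      · exact absurd hij (hlt j i hj' hi' h).ne'
    calc m = (Finset.range m : Set ℕ).ncard := by simp
      _ = (r '' (Finset.range m : Set ℕ)).ncard := hinj.ncard_image.symm
      _ ≤ _ := ncard_le_ncard hsub (hσ.finite_switchTimes _ _)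
  have hcard' : (m : ℝ) ≤ numSwitches σ ((K + m : ℕ) * (τa / 2)) (K * (τa / 2)) := by
    exact_mod_cast hcard
  have hsimp : (((K + m : ℕ) : ℝ) * (τa / 2) - K * (τa / 2)) / τa = m / 2 := by
    push_cast
    field_simp
    ring
  rw [hsimp] at hN
  linarith

end Switching

/-! ### One-sided behaviour of the period counter -/

section Floor

theorem eventually_right_floor_eq (T₀ : ℝ) {T : ℝ} (hT : 0 < T) {t : ℝ} (ht : T₀ ≤ t) :
    ∀ᶠ s in 𝓝[>] t, ⌊(s - T₀) / T⌋₊ = ⌊(t - T₀) / T⌋₊ := by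
  have h0 : 0 ≤ (t - T₀) / T := div_nonneg (sub_nonneg.2 ht) hT.le
  have hlt : t < T₀ + (⌊(t - T₀) / T⌋₊ + 1) * T := by
    have := (div_lt_iff₀ hT).1 (Nat.lt_floor_add_one ((t - T₀) / T))
    linarith
  filter_upwards [Ioo_mem_nhdsGT hlt] with s hs
  have h1 : (t - T₀) / T ≤ (s - T₀) / T := by
    have := hs.1.le
    gcongr
  rw [Nat.floor_eq_iff (h0.trans h1)]
  refine ⟨(Nat.floor_le h0).trans h1, ?_⟩
  rw [div_lt_iff₀ hT]
  linarith [hs.2]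

/-- The counter jumps at t only if (t − T₀)/T is an integer. The two alternatives separate the end
of a zoom period from its interior. -/
theorem exists_eventually_left_floor_eq (T₀ : ℝ) {T : ℝ} (hT : 0 < T) {t : ℝ} (ht : T₀ < t) :
    ∃ k : ℕ, (∀ᶠ s in 𝓝[<] t, ⌊(s - T₀) / T⌋₊ = k) ∧
      (⌊(t - T₀) / T⌋₊ = k ∨ ⌊(t - T₀) / T⌋₊ = k + 1 ∧ t = T₀ + (k + 1) * T) := by
  have h0 : 0 < (t - T₀) / T := div_pos (sub_pos.2 ht) hT
  have hfl := Nat.floor_le h0.le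
  have hlt : t < T₀ + (⌊(t - T₀) / T⌋₊ + 1) * T := by
    have := (div_lt_iff₀ hT).1 (Nat.lt_floor_add_one ((t - T₀) / T))
    linarith
  rcases hfl.eq_or_lt with heq | hne
  · obtain ⟨k, hk⟩ : ∃ k, ⌊(t - T₀) / T⌋₊ = k + 1 :=
      Nat.exists_eq_succ_of_ne_zero fun hz => by
        rw [hz, Nat.cast_zero] at heq
        exact h0.ne heq
    rw [hk] at heq
    have ht' : t = T₀ + (k + 1) * T := by
      rw [eq_div_iff hT.ne'] at heq
      push_cast at heq
      linarith
    refine ⟨k, ?_, Or.inr ⟨hk, ht'⟩⟩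
    filter_upwards [Ioo_mem_nhdsLT (show T₀ + k * T < t by rw [ht']; linarith)] with s hs
    have hks : (k : ℝ) ≤ (s - T₀) / T := by
      rw [le_div_iff₀ hT]
      linarith [hs.1]
    rw [Nat.floor_eq_iff ((Nat.cast_nonneg k).trans hks)]
    refine ⟨hks, ?_⟩
    rw [div_lt_iff₀ hT]
    linarith [hs.2]
  · refine ⟨⌊(t - T₀) / T⌋₊, ?_, Or.inl rfl⟩
    have hlt' : T₀ + ⌊(t - T₀) / T⌋₊ * T < t := by
      rw [lt_div_iff₀ hT] at hne
      linarith
    filter_upwards [Ioo_mem_nhdsLT hlt'] with s hs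
    have hks : (⌊(t - T₀) / T⌋₊ : ℝ) ≤ (s - T₀) / T := by
      rw [le_div_iff₀ hT]
      linarith [hs.1]
    rw [Nat.floor_eq_iff ((Nat.cast_nonneg _).trans hks)]
    refine ⟨hks, ?_⟩
    rw [div_lt_iff₀ hT]
    linarith [hs.2]

/-- A function of `⌊t / T⌋₊` is piecewise constant. -/
theorem isPiecewiseConstant_floor {α : Type*} (φ : ℕ → α) {T : ℝ} (hT : 0 < T) :
    IsPiecewiseConstant fun t : ℝ => φ ⌊t / T⌋₊ := by
  refine ⟨fun t ht => ?_, fun t ht => ?_⟩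
  · filter_upwards [eventually_right_floor_eq 0 hT ht] with s hs
    simp only [sub_zero] at hs
    rw [hs]
  · obtain ⟨k, hk, -⟩ := exists_eventually_left_floor_eq 0 hT ht
    refine ⟨φ k, ?_⟩
    filter_upwards [hk] with s hs
    simp only [sub_zero] at hs
    rw [hs]

end Floor

/-! ### The zoom parameter of the zooming-in stage -/

section ZoomIn

variable {ι : Type*} {σ : ℝ → ι} {Ω T : ℝ} {c : ι → ι → ℝ} {T₀ μ₀ : ℝ}

theorem IsPiecewiseConstant.finprod_pos (hσ : IsPiecewiseConstant σ)
    (hc : ∀ i j, i ≠ j → 0 < c j i) (s t : ℝ) :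
    0 < ∏ᶠ r ∈ switchTimes σ ∩ Ioc s t, c (σ r) (modeBefore σ r) := by
  rw [finprod_mem_eq_finite_toFinset_prod _ (hσ.finite_switchTimes s t)]
  refine Finset.prod_pos fun r hr => hc _ _ (hσ.modeBefore_ne ?_)
  exact ((hσ.finite_switchTimes s t).mem_toFinset.1 hr).1

theorem zoomIn_pos (hσ : IsPiecewiseConstant σ) (hΩ : 0 < Ω) (hc : ∀ i j, i ≠ j → 0 < c j i)
    (hμ₀ : 0 < μ₀) (t : ℝ) : 0 < zoomIn Ω T c σ T₀ μ₀ t :=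
  mul_pos (mul_pos (pow_pos hΩ _) (Real.sqrt_pos.2 (hσ.finprod_pos hc _ _))) hμ₀

theorem zoomIn_self : zoomIn Ω T c σ T₀ μ₀ T₀ = μ₀ := by
  simp [zoomIn]

theorem zoomIn_eventually_right (hσ : IsPiecewiseConstant σ) (hT : 0 < T) (hT₀ : 0 ≤ T₀) {t : ℝ}
    (ht : T₀ ≤ t) : ∀ᶠ s in 𝓝[>] t, zoomIn Ω T c σ T₀ μ₀ s = zoomIn Ω T c σ T₀ μ₀ t := by
  filter_upwards [eventually_right_floor_eq T₀ hT ht, hσ.eventually_right_notMem (hT₀.trans ht),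
    self_mem_nhdsWithin] with s hfl hno hts
  have : switchTimes σ ∩ Ioc T₀ s = switchTimes σ ∩ Ioc T₀ t := by
    ext r
    refine ⟨fun hr => ⟨hr.1, hr.2.1, ?_⟩, fun hr => ⟨hr.1, hr.2.1, hr.2.2.trans (le_of_lt hts)⟩⟩
    by_contra hlt
    exact hno r ⟨not_le.1 hlt, hr.2.2⟩ hr.1
  rw [zoomIn, zoomIn, hfl, this]

-- Just before t there are no switches, so the product changes only by the factor at t itself. The
-- truncated exponent is a true difference because the floor is monotone.
open scoped Classical in
theorem zoomIn_eventually_left (hσ : IsPiecewiseConstant σ) (hc : ∀ i j, i ≠ j → 0 < c j i)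
    (hT : 0 < T) (hT₀ : 0 ≤ T₀) {t : ℝ} (ht : T₀ < t) :
    ∀ᶠ s in 𝓝[<] t, zoomIn Ω T c σ T₀ μ₀ t = Ω ^ (⌊(t - T₀) / T⌋₊ - ⌊(s - T₀) / T⌋₊) *
      √(if t ∈ switchTimes σ then c (σ t) (modeBefore σ t) else 1) * zoomIn Ω T c σ T₀ μ₀ s := by
  filter_upwards [hσ.eventually_left_notMem (hT₀.trans_lt ht), Ioo_mem_nhdsLT ht] with s hno hs
  have hpow : Ω ^ ⌊(t - T₀) / T⌋₊ =
      Ω ^ (⌊(t - T₀) / T⌋₊ - ⌊(s - T₀) / T⌋₊) * Ω ^ ⌊(s - T₀) / T⌋₊ := by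
    rw [← pow_add, Nat.sub_add_cancel]
    have := hs.2.le
    gcongr
  have hprod : ∏ᶠ r ∈ switchTimes σ ∩ Ioc T₀ t, c (σ r) (modeBefore σ r) =
      (if t ∈ switchTimes σ then c (σ t) (modeBefore σ t) else 1) *
        ∏ᶠ r ∈ switchTimes σ ∩ Ioc T₀ s, c (σ r) (modeBefore σ r) := by
    split_ifs with hmem
    · have : switchTimes σ ∩ Ioc T₀ t = insert t (switchTimes σ ∩ Ioc T₀ s) := by
        ext r
        constructor
        · rintro ⟨hr, hr1, hr2⟩
          rcases hr2.eq_or_lt with h | h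
          · exact Or.inl h
          · refine Or.inr ⟨hr, hr1, ?_⟩
            by_contra hlt
            exact hno r ⟨not_le.1 hlt, h⟩ hr
        · rintro (rfl | ⟨hr, hr1, hr2⟩)
          · exact ⟨hmem, ht, le_rfl⟩
          · exact ⟨hr, hr1, hr2.trans hs.2.le⟩
      rw [this, finprod_mem_insert _ (fun h => absurd h.2.2 (not_le.2 hs.2))
        (hσ.finite_switchTimes _ _)]
    · have : switchTimes σ ∩ Ioc T₀ t = switchTimes σ ∩ Ioc T₀ s := by
        ext r
        constructor
        · rintro ⟨hr, hr1, hr2⟩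
          rcases hr2.eq_or_lt with h | h
          · exact absurd (h ▸ hr) hmem
          · refine ⟨hr, hr1, ?_⟩
            by_contra hlt
            exact hno r ⟨not_le.1 hlt, h⟩ hr
        · rintro ⟨hr, hr1, hr2⟩
          exact ⟨hr, hr1, hr2.trans hs.2.le⟩
      rw [this, one_mul]
  rw [zoomIn, zoomIn, hpow, hprod, Real.sqrt_mul' _ (hσ.finprod_pos hc _ _).le]
  ring

/-- The jump factor at t is eventually constant from the left and positive, so it can be divided out
of the value at t. -/
theorem zoomIn_exists_left (hσ : IsPiecewiseConstant σ) (hΩ : 0 < Ω)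
    (hc : ∀ i j, i ≠ j → 0 < c j i) (hT : 0 < T) (hT₀ : 0 ≤ T₀) {t : ℝ} (ht : T₀ < t) :
    ∃ a, ∀ᶠ s in 𝓝[<] t, zoomIn Ω T c σ T₀ μ₀ s = a := by
  classical
  obtain ⟨k, hk, -⟩ := exists_eventually_left_floor_eq T₀ hT ht
  refine ⟨(Ω ^ (⌊(t - T₀) / T⌋₊ - k) *
      √(if t ∈ switchTimes σ then c (σ t) (modeBefore σ t) else 1))⁻¹ *
        zoomIn Ω T c σ T₀ μ₀ t, ?_⟩
  filter_upwards [hk, zoomIn_eventually_left (μ₀ := μ₀) (Ω := Ω) hσ hc hT hT₀ ht] with s hs h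
  rw [h, hs, inv_mul_cancel_left₀]
  have : 0 < if t ∈ switchTimes σ then c (σ t) (modeBefore σ t) else 1 := by
    split_ifs with hmem
    · exact hc _ _ (hσ.modeBefore_ne hmem)
    · exact one_pos
  positivity

/-- A zoom parameter that follows a piecewise constant function before `T₀` and the zooming-in law
afterwards is piecewise constant. -/
theorem isPiecewiseConstant_of_eq_zoomIn {out μ : ℝ → ℝ} (hσ : IsPiecewiseConstant σ) (hΩ : 0 < Ω)
    (hc : ∀ i j, i ≠ j → 0 < c j i) (hT : 0 < T) (hT₀ : 0 ≤ T₀) (hout : IsPiecewiseConstant out)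
    (h1 : ∀ t, 0 ≤ t → t < T₀ → μ t = out t)
    (h2 : ∀ t, T₀ ≤ t → μ t = zoomIn Ω T c σ T₀ μ₀ t) : IsPiecewiseConstant μ := by
  refine ⟨fun t ht => ?_, fun t ht => ?_⟩
  · rcases lt_or_ge t T₀ with h | h
    · filter_upwards [hout.1 t ht, Ioo_mem_nhdsGT h] with s hs hs'
      rw [h1 s (ht.trans hs'.1.le) hs'.2, h1 t ht h, hs]
    · filter_upwards [zoomIn_eventually_right (Ω := Ω) (c := c) (μ₀ := μ₀) hσ hT hT₀ h,
        self_mem_nhdsWithin] with s hs hs'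
      rw [h2 s (h.trans (le_of_lt hs')), h2 t h, hs]
  · rcases le_or_gt t T₀ with h | h
    · obtain ⟨a, ha⟩ := hout.2 t ht
      refine ⟨a, ?_⟩
      filter_upwards [ha, Ioo_mem_nhdsLT ht] with s hs hs'
      rw [h1 s hs'.1.le (hs'.2.trans_le h), hs]
    · obtain ⟨a, ha⟩ := zoomIn_exists_left (μ₀ := μ₀) hσ hΩ hc hT hT₀ h
      refine ⟨a, ?_⟩
      filter_upwards [ha, Ioo_mem_nhdsLT h] with s hs hs'
      rw [h2 s hs'.1.le, hs]

/-- Since cb ≥ 1, the bound on the number of switches bounds the product. The constant log(1/Ω)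
comes from ⌊x⌋ ≥ x − 1, the other constant from the chatter bound; the terms linear in t − T₀ form
the decay rate. -/
theorem zoomIn_le {τa N₀ cb : ℝ} (hσ : IsPiecewiseConstant σ) (hadt : HasAverageDwellTime σ τa N₀)
    (hΩ : 0 < Ω) (hΩ1 : Ω < 1) (hT₀ : 0 ≤ T₀) (hμ₀ : 0 < μ₀)
    (hc : ∀ i j, i ≠ j → 0 < c j i) (hcb : ∀ i j, i ≠ j → c j i ≤ cb) (hcb1 : 1 ≤ cb) {t : ℝ}
    (ht : T₀ < t) : zoomIn Ω T c σ T₀ μ₀ t ≤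
      μ₀ * Real.exp (Real.log (1 / Ω) + Real.log cb * N₀ / 2) *
        Real.exp (-(Real.log (1 / Ω) / T - Real.log cb / (2 * τa)) * (t - T₀)) := by
  have hcb0 : 0 < cb := one_pos.trans_le hcb1
  have hlogcb : 0 ≤ Real.log cb := Real.log_nonneg hcb1
  have hprod : ∏ᶠ r ∈ switchTimes σ ∩ Ioc T₀ t, c (σ r) (modeBefore σ r) ≤
      Real.exp (Real.log cb * (N₀ + (t - T₀) / τa)) := by
    have hfin := hσ.finite_switchTimes T₀ t
    rw [finprod_mem_eq_finite_toFinset_prod _ hfin]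
    have hmem : ∀ r ∈ hfin.toFinset, modeBefore σ r ≠ σ r := fun r hr =>
      hσ.modeBefore_ne (hfin.mem_toFinset.1 hr).1
    calc ∏ r ∈ hfin.toFinset, c (σ r) (modeBefore σ r) ≤ ∏ r ∈ hfin.toFinset, cb :=
          Finset.prod_le_prod (fun r hr => (hc _ _ (hmem r hr)).le) fun r hr => hcb _ _ (hmem r hr)
      _ = cb ^ numSwitches σ t T₀ := by
          rw [Finset.prod_const, numSwitches, ncard_eq_toFinset_card _ hfin]
      _ = Real.exp (Real.log cb * numSwitches σ t T₀) := by
          rw [mul_comm, Real.exp_nat_mul, Real.exp_log hcb0]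
      _ ≤ _ := by
          have := hadt T₀ t hT₀ ht
          gcongr
  have hlogΩ : 0 < Real.log (1 / Ω) := Real.log_pos (by rw [lt_div_iff₀ hΩ]; linarith)
  have hpow : Ω ^ ⌊(t - T₀) / T⌋₊ ≤ Real.exp (-Real.log (1 / Ω) * ((t - T₀) / T - 1)) := by
    have h1 : Ω ^ ⌊(t - T₀) / T⌋₊ = Real.exp (-Real.log (1 / Ω) * ⌊(t - T₀) / T⌋₊) := by
      rw [mul_comm, Real.exp_nat_mul, one_div, Real.log_inv, neg_neg, Real.exp_log hΩ]
    rw [h1]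
    have := Nat.lt_floor_add_one ((t - T₀) / T)
    refine Real.exp_le_exp.2 ?_
    nlinarith
  have hsqrt : √(∏ᶠ r ∈ switchTimes σ ∩ Ioc T₀ t, c (σ r) (modeBefore σ r)) ≤
      Real.exp (Real.log cb * (N₀ + (t - T₀) / τa) / 2) := by
    rw [Real.exp_half]
    exact Real.sqrt_le_sqrt hprod
  calc zoomIn Ω T c σ T₀ μ₀ t ≤ Real.exp (-Real.log (1 / Ω) * ((t - T₀) / T - 1)) *
        Real.exp (Real.log cb * (N₀ + (t - T₀) / τa) / 2) * μ₀ := by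
        unfold zoomIn
        gcongr
    _ = _ := by
        rw [mul_comm _ μ₀, mul_assoc, ← Real.exp_add, ← Real.exp_add]
        congr 2
        ring

end ZoomIn

/-! ### Matrices acting on Euclidean vectors -/

section Act

variable {κ κ₁ κ₂ : Type*} [Fintype κ₁] [Fintype κ₂]

/-- A matrix as a continuous linear map between Euclidean spaces. -/
def actL [Fintype κ] [DecidableEq κ₁] (A : Matrix κ κ₁ ℝ) :
    EuclideanSpace ℝ κ₁ →L[ℝ] EuclideanSpace ℝ κ :=
  (Matrix.toEuclideanLin A).toContinuousLinearMap

theorem act_eq_actL [Fintype κ] [DecidableEq κ₁] (A : Matrix κ κ₁ ℝ)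
    (v : EuclideanSpace ℝ κ₁) : act A v = actL A v := rfl

theorem norm_act_le [Fintype κ] [DecidableEq κ₁] (A : Matrix κ κ₁ ℝ)
    (v : EuclideanSpace ℝ κ₁) : ‖act A v‖ ≤ opNorm A * ‖v‖ :=
  Matrix.l2_opNorm_mulVec A v

theorem opNorm_nonneg [Fintype κ] [DecidableEq κ₁] (A : Matrix κ κ₁ ℝ) : 0 ≤ opNorm A :=
  norm_nonneg (actL A)

theorem act_mul (A : Matrix κ κ₁ ℝ) (B : Matrix κ₁ κ₂ ℝ) (v : EuclideanSpace ℝ κ₂) :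
    act (A * B) v = act A (act B v) := by
  simp [act, Matrix.mulVec_mulVec]

theorem inner_act_left [Fintype κ] (A : Matrix κ κ₁ ℝ) (v : EuclideanSpace ℝ κ₁)
    (w : EuclideanSpace ℝ κ) : inner ℝ (act A v) w = w.ofLp ⬝ᵥ (A *ᵥ v.ofLp) := by
  simp [act, PiLp.inner_apply, dotProduct, mul_comm]

theorem inner_act_comm [Fintype κ] (A : Matrix κ κ₁ ℝ) (v : EuclideanSpace ℝ κ₁)
    (w : EuclideanSpace ℝ κ) : inner ℝ (act A v) w = inner ℝ v (act Aᵀ w) := by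
  rw [real_inner_comm (act Aᵀ w) v, inner_act_left, inner_act_left, Matrix.mulVec_transpose,
    Matrix.dotProduct_mulVec, dotProduct_comm]

end Act

/-! ### Norms of the combined state z = (x, x − ξ) -/

section ZSpace

variable {n : ℕ}

theorem norm_sq_eq_add (z : ZSpace n) :
    ‖z‖ ^ 2 = ‖stateOf z‖ ^ 2 + ∑ i, (z (Sum.inr i)) ^ 2 := by
  simp [EuclideanSpace.norm_sq_eq, stateOf]

theorem norm_stateOf_le (z : ZSpace n) : ‖stateOf z‖ ≤ ‖z‖ := by
  refine le_of_sq_le_sq ?_ (norm_nonneg _)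
  rw [norm_sq_eq_add]
  have : 0 ≤ ∑ i, (z (Sum.inr i)) ^ 2 := Finset.sum_nonneg fun i _ => sq_nonneg _
  linarith

theorem norm_sq_of_observerOf_eq_zero {z : ZSpace n} (h : observerOf z = 0) :
    ‖z‖ ^ 2 = 2 * ‖stateOf z‖ ^ 2 := by
  have h' : ∀ i, z (Sum.inr i) = z (Sum.inl i) := fun i => by
    have := congrArg (fun v : EuclideanSpace ℝ (Fin n) => v i) h
    simp only [observerOf, PiLp.zero_apply] at this
    linarith
  rw [norm_sq_eq_add, two_mul]
  congr 1
  simp [EuclideanSpace.norm_sq_eq, stateOf, h']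

end ZSpace

/-! ### Filippov regularization -/

section Filippov

variable {κ : Type*} [Fintype κ]

/-- A bound for a continuous convex function that holds approximately for the values of a vector
field near `z` holds on its Filippov regularization at `z`. -/
theorem le_of_mem_filippov {f : EuclideanSpace ℝ κ → EuclideanSpace ℝ κ} {z g : EuclideanSpace ℝ κ}
    (hg : g ∈ filippov f z) {φ : EuclideanSpace ℝ κ → ℝ} (hφ : Continuous φ)
    (hconv : ConvexOn ℝ univ φ) {β : ℝ} (h : ∀ ε > 0, ∀ᶠ w in 𝓝 z, φ (f w) ≤ β + ε) :
    φ g ≤ β := by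
  refine le_of_forall_pos_le_add fun ε hε => ?_
  obtain ⟨δ, hδ, hball⟩ := Metric.eventually_nhds_iff_ball.1 (h ε hε)
  simp only [filippov, mem_iInter] at hg
  -- Discarding the empty null set is enough, because the bound holds at every nearby point.
  -- Sublevel sets of φ are closed and convex, so they contain the closed convex hull.
  have hmem := hg δ hδ ∅ (by simp)
  have hset : closure (convexHull ℝ (f '' (Metric.ball z δ \ ∅))) ⊆ {w | φ w ≤ β + ε} := by
    refine closure_minimal (convexHull_min ?_ ?_) (isClosed_le hφ continuous_const)
    · rintro _ ⟨w, hw, rfl⟩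
      exact hball w hw.1
    · simpa using hconv.convex_le (β + ε)
  exact hset hmem

end Filippov

/-! ### Quantizers -/

section Quantizer

variable {p : ℕ} {q : EuclideanSpace ℝ (Fin p) → EuclideanSpace ℝ (Fin p)} {M Δ : ℝ}

theorem norm_inv_smul_le_iff {E : Type*} [NormedAddCommGroup E] [NormedSpace ℝ E] {μ a : ℝ}
    (hμ : 0 < μ) (y : E) : ‖μ⁻¹ • y‖ ≤ a ↔ ‖y‖ ≤ a * μ := by
  rw [norm_smul, norm_inv, Real.norm_of_nonneg hμ.le, inv_mul_eq_div, div_le_iff₀ hμ]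

theorem IsQuantizer.zoomed_error_le (hq : IsQuantizer q M Δ) {μ : ℝ} (hμ : 0 < μ)
    {y : EuclideanSpace ℝ (Fin p)} (hy : ‖y‖ ≤ M * μ) : ‖zoomed q μ y - y‖ ≤ Δ * μ := by
  have h := hq.error_le (μ⁻¹ • y) ((norm_inv_smul_le_iff hμ y).2 hy)
  have heq : zoomed q μ y - y = μ • (q (μ⁻¹ • y) - μ⁻¹ • y) := by
    rw [smul_sub, smul_inv_smul₀ hμ.ne', zoomed]
  rw [heq, norm_smul, Real.norm_of_nonneg hμ.le, mul_comm]
  gcongr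

/-- Contrapositive of the saturation property: the controller can recognize from received data alone
that the output is in range. -/
theorem IsQuantizer.norm_le_of_zoomed_le (hq : IsQuantizer q M Δ) {μ : ℝ} (hμ : 0 < μ)
    {y : EuclideanSpace ℝ (Fin p)} (hy : ‖zoomed q μ y‖ ≤ (M - Δ) * μ) : ‖y‖ ≤ M * μ := by
  rw [← norm_inv_smul_le_iff hμ]
  by_contra! hlt
  have h := hq.saturation _ hlt
  rw [zoomed, norm_smul, Real.norm_of_nonneg hμ.le] at hy
  nlinarith

/-- For ‖y‖ ≤ Δ₀μ the quantized value is 0; otherwise it is at most μR ≤ (R/Δ₀)‖y‖, where R bounds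
the finitely many values of q. Thus K does not depend on μ. -/
theorem IsQuantizer.exists_zoomed_sub_le (hq : IsQuantizer q M Δ) :
    ∃ K, 0 ≤ K ∧ ∀ μ, 0 < μ → ∀ y, ‖zoomed q μ y - y‖ ≤ K * ‖y‖ := by
  obtain ⟨Δ₀, hΔ₀, h0⟩ := hq.near_zero
  obtain ⟨R, hR⟩ := hq.finite_range.isBounded.exists_norm_le
  have hR0 : 0 ≤ R := (norm_nonneg _).trans (hR _ (mem_range_self 0))
  refine ⟨R / Δ₀ + 1, by positivity, fun μ hμ y => ?_⟩
  refine (norm_sub_le _ _).trans ?_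
  rw [add_mul, one_mul]
  gcongr
  rw [zoomed, norm_smul, Real.norm_of_nonneg hμ.le]
  by_cases hy : ‖μ⁻¹ • y‖ ≤ Δ₀
  · rw [h0 _ hy, norm_zero, mul_zero]
    positivity
  · rw [norm_inv_smul_le_iff hμ, not_le] at hy
    calc μ * ‖q (μ⁻¹ • y)‖ ≤ μ * R := by
          gcongr
          exact hR _ (mem_range_self _)
      _ = R / Δ₀ * (Δ₀ * μ) := by field_simp
      _ ≤ R / Δ₀ * ‖y‖ := by gcongr

end Quantizer

/-! ### Estimates for the closed-loop vector field -/

section Field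

variable {ι : Type*} {n m p : ℕ}

/-- Constants that bound the Lyapunov functions `z ↦ zᵀ P_i z` and the outputs of a switched
system. -/
structure LyapunovBounds (sys : SwitchedSystem ι n m p)
    (P Q : ι → Matrix (Fin n ⊕ Fin n) (Fin n ⊕ Fin n) ℝ) (lP LP lQ Θ Cm : ℝ) : Prop where
  lP_pos : 0 < lP
  LP_pos : 0 < LP
  lQ_pos : 0 < lQ
  Θ_pos : 0 < Θ
  Cm_pos : 0 < Cm
  P_symm : ∀ i (z w : ZSpace n), inner ℝ (act (P i) z) w = inner ℝ z (act (P i) w)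
  P_lower : ∀ i (z : ZSpace n), lP * ‖z‖ ^ 2 ≤ inner ℝ (act (P i) z) z
  P_upper : ∀ i (z : ZSpace n), inner ℝ (act (P i) z) z ≤ LP * ‖z‖ ^ 2
  Q_lower : ∀ i (z : ZSpace n), lQ * ‖z‖ ^ 2 ≤ inner ℝ (act (Q i) z) z
  lyapunov : ∀ i (z : ZSpace n),
    2 * inner ℝ (act (P i) z) (act (sys.F i) z) = -inner ℝ (act (Q i) z) z
  gain : ∀ i e, ‖act (P i) (act (sys.Lhat i) e)‖ ≤ lQ * Θ / 2 * ‖e‖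
  output_le : ∀ i (z : ZSpace n), ‖sys.output i z‖ ≤ Cm * ‖z‖

variable {sys : SwitchedSystem ι n m p} {q : EuclideanSpace ℝ (Fin p) → EuclideanSpace ℝ (Fin p)}
  {M Δ : ℝ}

/-- Linear growth with a constant uniform in μ and in the mode lets Grönwall's inequality control z
while both vary. -/
theorem exists_norm_field_le [Finite ι] (sys : SwitchedSystem ι n m p) (hq : IsQuantizer q M Δ) :
    ∃ b, 0 ≤ b ∧ ∀ i μ, 0 < μ → ∀ z, ‖sys.field q i μ z‖ ≤ b * ‖z‖ := by
  obtain ⟨K, hK0, hK⟩ := hq.exists_zoomed_sub_le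
  obtain ⟨b, hb⟩ := (Set.finite_range fun i : ι =>
    opNorm (sys.F i) + opNorm (sys.Lhat i) * (K * opNorm (sys.C i))).bddAbove
  refine ⟨max b 0, le_max_right _ _, fun i μ hμ z => ?_⟩
  have hCz : ‖sys.output i z‖ ≤ opNorm (sys.C i) * ‖z‖ :=
    (norm_act_le _ _).trans (mul_le_mul_of_nonneg_left (norm_stateOf_le z) (opNorm_nonneg _))
  calc ‖sys.field q i μ z‖ ≤ opNorm (sys.F i) * ‖z‖ +
        opNorm (sys.Lhat i) * (K * (opNorm (sys.C i) * ‖z‖)) := by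
        refine (norm_add_le _ _).trans (add_le_add (norm_act_le _ _) ((norm_act_le _ _).trans ?_))
        refine mul_le_mul_of_nonneg_left ((hK μ hμ _).trans ?_) (opNorm_nonneg _)
        gcongr
    _ = (opNorm (sys.F i) + opNorm (sys.Lhat i) * (K * opNorm (sys.C i))) * ‖z‖ := by ring
    _ ≤ max b 0 * ‖z‖ := by
        gcongr
        exact (hb (mem_range_self i)).trans (le_max_left _ _)

theorem norm_le_of_mem_filippov_field {b μ : ℝ} {i : ι} (hb : ∀ z, ‖sys.field q i μ z‖ ≤ b * ‖z‖)
    {z g : ZSpace n} (hg : g ∈ filippov (sys.field q i μ) z) : ‖g‖ ≤ b * ‖z‖ := by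
  refine le_of_mem_filippov hg continuous_norm (convexOn_norm convex_univ) fun ε hε => ?_
  have : Tendsto (fun w : ZSpace n => b * ‖w‖) (𝓝 z) (𝓝 (b * ‖z‖)) :=
    (continuous_const.mul continuous_norm).tendsto z
  filter_upwards [this.eventually_lt_const (lt_add_of_pos_right _ hε)] with w hw
  exact (hb w).trans hw.le

variable {P Q : ι → Matrix (Fin n ⊕ Fin n) (Fin n ⊕ Fin n) ℝ} {lP LP lQ Θ Cm : ℝ}

/-- The derivative of the Lyapunov function along the closed loop, inside the range of the
quantizer. -/
theorem LyapunovBounds.inner_le_of_mem_filippov (hb : LyapunovBounds sys P Q lP LP lQ Θ Cm)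
    (hq : IsQuantizer q M Δ) {μ : ℝ} (hμ : 0 < μ) {i : ι} {z g : ZSpace n}
    (hz : Cm * ‖z‖ < M * μ) (hg : g ∈ filippov (sys.field q i μ) z) :
    2 * inner ℝ (act (P i) z) g ≤ -(lQ * ‖z‖ ^ 2) + lQ * Θ * Δ * μ * ‖z‖ := by
  set ℓ : ZSpace n →L[ℝ] ℝ := (2 : ℝ) • innerSL ℝ (act (P i) z) with hℓ
  have hℓa : ∀ w, ℓ w = 2 * inner ℝ (act (P i) z) w := fun w => by simp [hℓ]
  rw [← hℓa]
  refine le_of_mem_filippov hg ℓ.continuous (ℓ.toLinearMap.convexOn convex_univ) fun ε hε => ?_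
  -- Strictness of `hz` makes the error bound available at all points near z, as the Filippov
  -- regularization requires.
  have h1 : ∀ᶠ w in 𝓝 z, Cm * ‖w‖ < M * μ :=
    ((continuous_const.mul continuous_norm).tendsto z).eventually_lt_const hz
  have h2 : ∀ᶠ w in 𝓝 z, ℓ (act (sys.F i) w) < ℓ (act (sys.F i) z) + ε :=
    ((ℓ.comp (actL (sys.F i))).continuous.tendsto z).eventually_lt_const
      (lt_add_of_pos_right _ hε)
  filter_upwards [h1, h2] with w hw1 hw2
  set e := zoomed q μ (sys.output i w) - sys.output i w
  have he : ‖e‖ ≤ Δ * μ := hq.zoomed_error_le hμ ((hb.output_le i w).trans hw1.le)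
  have h3 : ℓ (act (sys.Lhat i) e) ≤ lQ * Θ * Δ * μ * ‖z‖ := by
    rw [hℓa, hb.P_symm]
    have h4 := real_inner_le_norm z (act (P i) (act (sys.Lhat i) e))
    have h5 := hb.gain i e
    have := hb.lQ_pos
    have := hb.Θ_pos
    calc 2 * inner ℝ z (act (P i) (act (sys.Lhat i) e))
        ≤ 2 * (‖z‖ * (lQ * Θ / 2 * (Δ * μ))) := by
          refine mul_le_mul_of_nonneg_left (h4.trans ?_) two_pos.le
          refine mul_le_mul_of_nonneg_left (h5.trans ?_) (norm_nonneg _)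
          gcongr
      _ = _ := by ring
  have h6 : ℓ (act (sys.F i) z) ≤ -(lQ * ‖z‖ ^ 2) := by
    rw [hℓa, hb.lyapunov]
    exact neg_le_neg (hb.Q_lower i z)
  have h7 : ℓ (sys.field q i μ w) = ℓ (act (sys.F i) w) + ℓ (act (sys.Lhat i) e) := by
    rw [← map_add]
    rfl
  rw [h7]
  linarith

end Field

/-! ### The zooming-in stage -/

section ZoomingIn

theorem IsSolutionOn.exists_isPrimitiveOn {κ : Type*} [Fintype κ]
    {G : ℝ → EuclideanSpace ℝ κ → Set (EuclideanSpace ℝ κ)} {a : ℝ} {I : Set ℝ}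
    {z : ℝ → EuclideanSpace ℝ κ} (h : IsSolutionOn G a I z) :
    ∃ g : ℝ → EuclideanSpace ℝ κ, (∀ b, Icc a b ⊆ I → IsPrimitiveOn z g a b) ∧
      ∀ᵐ t, t ∈ I → g t ∈ G t (z t) := by
  obtain ⟨g, hg, hg'⟩ := h
  exact ⟨g, fun b hb t ht => hg t (hb ht), hg'⟩

variable {ι : Type*} {n m p : ℕ} {sys : SwitchedSystem ι n m p}
  {q : EuclideanSpace ℝ (Fin p) → EuclideanSpace ℝ (Fin p)} {M Δ : ℝ}
  {P Q : ι → Matrix (Fin n ⊕ Fin n) (Fin n ⊕ Fin n) ℝ} {lP LP lQ Θ Cm : ℝ}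

/-- Decay of the Lyapunov function while mode and zoom parameter are constant and the quantizer
does not saturate. -/
theorem LyapunovBounds.decay (hb : LyapunovBounds sys P Q lP LP lQ Θ Cm) (hq : IsQuantizer q M Δ)
    {K : ℝ} (hK0 : 0 ≤ K) (hK : ∀ i μ, 0 < μ → ∀ z, ‖sys.field q i μ z‖ ≤ K * ‖z‖)
    {κ μ a b : ℝ} (hκ : 0 < κ) (hμ : 0 < μ) (hab : a ≤ b) {i : ι} {z g : ℝ → ZSpace n}
    (hz : IsPrimitiveOn z g a b)
    (hg : ∀ᵐ t, t ∈ Icc a b → g t ∈ filippov (sys.field q i μ) (z t))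
    (hsat : ∀ t ∈ Icc a b, Cm * ‖z t‖ < M * μ) :
    inner ℝ (act (P i) (z b)) (z b) ≤ max (LP * (Θ * Δ * (1 + κ)) ^ 2 * μ ^ 2)
      (inner ℝ (act (P i) (z a)) (z a) - lQ * κ * (1 + κ) * (Θ * Δ) ^ 2 * μ ^ 2 * (b - a)) := by
  have hΘ := hb.Θ_pos
  have hΔ := hq.pos
  have hlQ := hb.lQ_pos
  have hLP := hb.LP_pos
  have hCm := hb.Cm_pos
  set f : ℝ → ℝ := fun t => inner ℝ (act (P i) (z t)) (z t)
  set r : ℝ := LP * (Θ * Δ * (1 + κ)) ^ 2 * μ ^ 2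
  set ρ : ℝ := lQ * κ * (1 + κ) * (Θ * Δ) ^ 2 * μ ^ 2
  have hcont : ContinuousOn f (Icc a b) :=
    ((actL (P i)).continuous.comp_continuousOn hz.continuousOn).inner hz.continuousOn
  have hbd : ∀ᵐ t, t ∈ Icc a b → ‖g t‖ ≤ K * (M * μ / Cm) := by
    filter_upwards [hg] with t ht hmem
    refine (norm_le_of_mem_filippov_field (hK i μ hμ) (ht hmem)).trans ?_
    gcongr
    rw [le_div_iff₀ hCm, mul_comm]
    exact (hsat t hmem).le
  -- Above level r both factors of ‖z‖(‖z‖ − ΘΔμ) are bounded below, by ΘΔ(1+κ)μ and ΘΔκμ; times lQ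
  -- this is ρ.
  have hderiv : ∀ᵐ t, t ∈ Icc a b → r ≤ f t → 2 * inner ℝ (act (P i) (z t)) (g t) ≤ -ρ := by
    filter_upwards [hg] with t ht hmem hrf
    have h1 := hb.inner_le_of_mem_filippov hq hμ (hsat t hmem) (ht hmem)
    have h2 : (Θ * Δ * (1 + κ) * μ) ^ 2 ≤ ‖z t‖ ^ 2 := by
      have h3 : LP * (Θ * Δ * (1 + κ) * μ) ^ 2 ≤ LP * ‖z t‖ ^ 2 := by
        refine le_trans (le_of_eq ?_) (hrf.trans (hb.P_upper i (z t)))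
        simp only [r]
        ring
      exact le_of_mul_le_mul_left h3 hLP
    have h4 : Θ * Δ * (1 + κ) * μ ≤ ‖z t‖ := le_of_sq_le_sq h2 (norm_nonneg _)
    have h5 : Θ * Δ * κ * μ ≤ ‖z t‖ - Θ * Δ * μ := by linarith
    have h6 : (Θ * Δ * (1 + κ) * μ) * (Θ * Δ * κ * μ) ≤ ‖z t‖ * (‖z t‖ - Θ * Δ * μ) :=
      mul_le_mul h4 h5 (by positivity) (norm_nonneg _)
    have h7 : ρ = lQ * ((Θ * Δ * (1 + κ) * μ) * (Θ * Δ * κ * μ)) := by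
      simp only [ρ]
      ring
    rw [h7]
    refine h1.trans ?_
    have := mul_le_mul_of_nonneg_left h6 hlQ.le
    linarith
  have hdec : ∀ s ∈ Icc a b, (∀ t ∈ Ioc s b, r ≤ f t) → f b ≤ f s - ρ * (b - s) := by
    intro s hs hrs
    refine (hz.mono hs.1 le_rfl).quadratic_le hs.2 (actL (P i)) (hb.P_symm i)
      (B := K * (M * μ / Cm)) ?_ ?_
    · filter_upwards [hbd] with t ht hmem
      exact ht ⟨hs.1.trans hmem.1, hmem.2⟩
    -- The left end point may lie outside the region f ≥ r, but it is a null set.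
    · have hne : ∀ᵐ t : ℝ, t ≠ s := compl_mem_ae_iff.2 (measure_singleton s)
      filter_upwards [hderiv, hne] with t ht hts hmem
      exact ht ⟨hs.1.trans hmem.1, hmem.2⟩ (hrs t ⟨lt_of_le_of_ne hmem.1 hts.symm, hmem.2⟩)
  -- If f ever reaches r, it cannot exceed r at b: after the last time with f ≤ r it is
  -- nonincreasing. Otherwise the decrease holds on all of [a, b].
  by_cases hex : ∃ s ∈ Icc a b, f s ≤ r
  · refine le_max_of_le_left ?_
    have hcl : IsCompact (Icc a b ∩ f ⁻¹' Iic r) :=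
      isCompact_Icc.of_isClosed_subset
        (hcont.preimage_isClosed_of_isClosed isClosed_Icc isClosed_Iic) inter_subset_left
    obtain ⟨s, ⟨hs, hsr⟩, hmax⟩ := hcl.exists_isGreatest hex
    have := hdec s hs fun t ht => by
      by_contra! hlt
      exact absurd (hmax ⟨⟨hs.1.trans ht.1.le, ht.2⟩, hlt.le⟩) (not_le.2 ht.1)
    have h0 : 0 ≤ ρ * (b - s) := mul_nonneg (by positivity) (sub_nonneg.2 hs.2)
    have hsr' : f s ≤ r := hsr
    change f b ≤ r
    linarith
  · push Not at hex
    exact le_max_of_le_right (hdec a (left_mem_Icc.2 hab) fun t ht =>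
      (hex t ⟨ht.1.le, ht.2⟩).le)

/-- The zooming-in law keeps the state in a sublevel set scaled by the zoom parameter. -/
theorem LyapunovBounds.zoomIn_invariant (hb : LyapunovBounds sys P Q lP LP lQ Θ Cm)
    (hq : IsQuantizer q M Δ)
    {K : ℝ} (hK0 : 0 ≤ K) (hK : ∀ i μ, 0 < μ → ∀ z, ‖sys.field q i μ z‖ ≤ K * ‖z‖)
    {κ Ω T : ℝ} {c : ι → ι → ℝ} (hκ : 0 < κ) (hΩ : 0 < Ω) (hΩ1 : Ω < 1) (hT : 0 < T)
    (hc : ∀ i j, i ≠ j → 0 < c j i)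
    (hcP : ∀ i j, i ≠ j → ∀ z : ZSpace n,
      inner ℝ (act (P j) z) z ≤ c j i * inner ℝ (act (P i) z) z)
    {r : ℝ} (hrΩ : r * Ω ^ 2 = LP * (Θ * Δ * (1 + κ)) ^ 2) (hrM : r * Cm ^ 2 < lP * M ^ 2)
    (hrT : r - lQ * κ * (1 + κ) * (Θ * Δ) ^ 2 * T ≤ LP * (Θ * Δ * (1 + κ)) ^ 2)
    {σ : ℝ → ι} {z : ℝ → ZSpace n} {μ : ℝ → ℝ} {T₀ μ₀ : ℝ} (hσ : IsPiecewiseConstant σ)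
    (hT₀ : 0 ≤ T₀) (hμ₀ : 0 < μ₀) (hμ : ∀ t, T₀ ≤ t → μ t = zoomIn Ω T c σ T₀ μ₀ t)
    (hz : IsSolutionOn (fun t => filippov (sys.field q (σ t) (μ t))) T₀ (Ici T₀) z)
    (hinit : inner ℝ (act (P (σ T₀)) (z T₀)) (z T₀) ≤ r * μ₀ ^ 2) :
    ∀ t, T₀ ≤ t → inner ℝ (act (P (σ t)) (z t)) (z t) ≤ r * μ t ^ 2 := by
  classical
  have hΘ := hb.Θ_pos
  have hΔ := hq.pos
  have hlQ := hb.lQ_pos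
  have hLP := hb.LP_pos
  have hCm := hb.Cm_pos
  have hM : 0 < M := hΔ.trans hq.lt
  obtain ⟨g, hprim, hg⟩ := hz.exists_isPrimitiveOn
  have hprim' : ∀ b, IsPrimitiveOn z g T₀ b := fun b => hprim b fun t ht => ht.1
  have hcontAt : ∀ t, T₀ < t → ContinuousAt z t := fun t ht =>
    (hprim' (t + 1)).continuousOn.continuousAt (Icc_mem_nhds ht (by linarith))
  have hcontR : ∀ t, T₀ ≤ t → Tendsto z (𝓝[>] t) (𝓝 (z t)) := fun t ht =>
    (((hprim' (t + 1)).continuousOn t ⟨ht, by linarith⟩).mono_of_mem_nhdsWithin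
      (mem_of_superset (Ioo_mem_nhdsGT (by linarith : t < t + 1)) fun s hs =>
        ⟨ht.trans hs.1.le, hs.2.le⟩))
  set r₂ : ℝ := LP * (Θ * Δ * (1 + κ)) ^ 2 with hr₂
  set ρ : ℝ := lQ * κ * (1 + κ) * (Θ * Δ) ^ 2 with hρ
  have hr₂0 : 0 < r₂ := by positivity
  have hρ0 : 0 < ρ := by positivity
  have hr0 : 0 < r := by
    have : 0 < r * Ω ^ 2 := hrΩ ▸ hr₂0
    exact pos_of_mul_pos_left this (by positivity)
  have hrr : r₂ ≤ r := by
    rw [← hrΩ]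
    have : Ω ^ 2 ≤ 1 := pow_le_one₀ hΩ.le hΩ1.le
    nlinarith
  have hμpos : ∀ t, T₀ ≤ t → 0 < μ t := fun t ht => hμ t ht ▸ zoomIn_pos hσ hΩ hc hμ₀ t
  -- The induction needs a bound on V/μ² that decreases within the k-th period: it starts at r,
  -- falls with slope ρ and stops at r₂. The counter k is a separate argument, so that h is
  -- continuous in t for fixed k and left limits can be taken.
  set h : ℝ → ℕ → ℝ := fun t k => max r₂ (r - ρ * (t - T₀ - k * T))
  suffices key : ∀ t, T₀ ≤ t → inner ℝ (act (P (σ t)) (z t)) (z t) ≤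
      h t ⌊(t - T₀) / T⌋₊ * μ t ^ 2 by
    intro t ht
    refine (key t ht).trans ?_
    gcongr
    refine max_le hrr ?_
    have : (⌊(t - T₀) / T⌋₊ : ℝ) * T ≤ t - T₀ := by
      rw [← le_div_iff₀ hT]
      exact Nat.floor_le (div_nonneg (sub_nonneg.2 ht) hT.le)
    nlinarith
  refine forall_ge_of_left_of_right ?_ ?_ ?_
  · rw [hμ T₀ le_rfl, zoomIn_self]
    refine hinit.trans ?_
    gcongr
    simp [h]
  · intro t ht ih
    have ht0 : 0 < t := hT₀.trans_lt ht
    obtain ⟨k, hk, hkt⟩ := exists_eventually_left_floor_eq T₀ hT ht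
    obtain ⟨ν, hν⟩ := zoomIn_exists_left (μ₀ := μ₀) hσ hΩ hc hT hT₀ ht
    set i := modeBefore σ t
    set j : ℝ := if t ∈ switchTimes σ then c (σ t) (modeBefore σ t) else 1 with hj
    have hj0 : 0 < j := by
      simp only [hj]
      split_ifs with hmem
      · exact hc _ _ (hσ.modeBefore_ne hmem)
      · exact one_pos
    -- A switch multiplies V by at most the same j that multiplies μ²; j = 1 if there is none.
    have hjump : inner ℝ (act (P (σ t)) (z t)) (z t) ≤ j * inner ℝ (act (P i) (z t)) (z t) := by
      simp only [hj]
      split_ifs with hmem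
      · exact hcP _ _ (hσ.modeBefore_ne hmem) _
      · rw [one_mul]
        simp only [i]
        rw [hσ.modeBefore_eq ht0 hmem]
    have hμt : μ t = Ω ^ (⌊(t - T₀) / T⌋₊ - k) * √j * ν := by
      obtain ⟨s, h1, h2, h3⟩ := ((zoomIn_eventually_left (μ₀ := μ₀) (Ω := Ω) hσ hc hT hT₀ ht).and
        (hk.and hν)).exists
      rw [hμ t ht.le, h1, h2, h3]
    have hleft : inner ℝ (act (P i) (z t)) (z t) ≤ h t k * ν ^ 2 := by
      have hzt : Tendsto z (𝓝[<] t) (𝓝 (z t)) :=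
        (hcontAt t ht).tendsto.mono_left nhdsWithin_le_nhds
      have l1 : Tendsto (fun s => inner ℝ (act (P i) (z s)) (z s)) (𝓝[<] t)
          (𝓝 (inner ℝ (act (P i) (z t)) (z t))) :=
        (((actL (P i)).continuous.tendsto (z t)).comp hzt).inner hzt
      have l2 : Tendsto (fun s => h s k * ν ^ 2) (𝓝[<] t) (𝓝 (h t k * ν ^ 2)) := by
        have : Continuous fun s => h s k * ν ^ 2 := by
          simp only [h]
          fun_prop
        exact (this.tendsto t).mono_left nhdsWithin_le_nhds
      refine le_of_tendsto_of_tendsto l1 l2 ?_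
      filter_upwards [hk, hν, hσ.eventually_left ht0, Ioo_mem_nhdsLT ht] with s h1 h2 h3 h4
      have := ih s ⟨h4.1.le, h4.2⟩
      rwa [h1, h3, hμ s h4.1.le, h2] at this
    have hμt2 : μ t ^ 2 = (Ω ^ (⌊(t - T₀) / T⌋₊ - k)) ^ 2 * j * ν ^ 2 := by
      rw [hμt, mul_pow, mul_pow, Real.sq_sqrt hj0.le]
    have hfin : inner ℝ (act (P (σ t)) (z t)) (z t) ≤ j * (h t k * ν ^ 2) :=
      hjump.trans (mul_le_mul_of_nonneg_left hleft hj0.le)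
    rw [hμt2]
    rcases hkt with hkt | ⟨hkt, htT⟩
    · rw [hkt, Nat.sub_self, pow_zero]
      linarith
    · rw [hkt, Nat.add_sub_cancel_left, pow_one]
      -- A full period has elapsed, so `hrT` gives the floor r₂ = rΩ²; the factor Ω² in the new μ²
      -- raises the admissible ratio back to r.
      have e1 : h t k = r₂ := by
        simp only [h]
        refine max_eq_left ?_
        have : t - T₀ - k * T = T := by rw [htT]; ring
        rw [this]
        exact hrT
      have e2 : h t (k + 1) = r := by
        simp only [h]
        have : t - T₀ - ((k + 1 : ℕ) : ℝ) * T = 0 := by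
          push_cast
          rw [htT]
          ring
        rw [this, mul_zero, sub_zero]
        exact max_eq_right hrr
      rw [e1] at hfin
      rw [e2]
      refine hfin.trans (le_of_eq ?_)
      rw [← hrΩ]
      ring
  · intro t ht hpt
    have hμt := hμpos t ht
    set k := ⌊(t - T₀) / T⌋₊ with hkdef
    have hhr : h t k ≤ r := by
      refine max_le hrr ?_
      have : (k : ℝ) * T ≤ t - T₀ := by
        rw [← le_div_iff₀ hT]
        exact Nat.floor_le (div_nonneg (sub_nonneg.2 ht) hT.le)
      nlinarith
    -- The current bound on V puts the output strictly in range, by `hrM`; continuity keeps it there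
    -- briefly, long enough to apply `decay`.
    have hsat : Cm * ‖z t‖ < M * μ t := by
      refine lt_of_pow_lt_pow_left₀ 2 (by positivity) ?_
      have h1 := hb.P_lower (σ t) (z t)
      have h2 : lP * ‖z t‖ ^ 2 ≤ r * μ t ^ 2 :=
        (h1.trans hpt).trans (mul_le_mul_of_nonneg_right hhr (by positivity))
      have h3 : r * Cm ^ 2 * μ t ^ 2 < lP * M ^ 2 * μ t ^ 2 :=
        mul_lt_mul_of_pos_right hrM (by positivity)
      have h4 : Cm ^ 2 * (lP * ‖z t‖ ^ 2) ≤ Cm ^ 2 * (r * μ t ^ 2) :=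
        mul_le_mul_of_nonneg_left h2 (by positivity)
      have h5 : lP * (Cm * ‖z t‖) ^ 2 < lP * (M * μ t) ^ 2 := by nlinarith
      exact lt_of_mul_lt_mul_left h5 hb.lP_pos.le
    have ev1 : ∀ᶠ s in 𝓝[>] t, Cm * ‖z s‖ < M * μ t :=
      (tendsto_const_nhds.mul (hcontR t ht).norm).eventually_lt_const hsat
    obtain ⟨u, hu, hsub⟩ := mem_nhdsGT_iff_exists_Ioo_subset.1
      (ev1.and ((hσ.1 t (hT₀.trans ht)).and
        ((zoomIn_eventually_right (Ω := Ω) (c := c) (μ₀ := μ₀) hσ hT hT₀ ht).and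
          (eventually_right_floor_eq T₀ hT ht))))
    filter_upwards [Ioo_mem_nhdsGT hu] with s hs
    have hall : ∀ w ∈ Icc t s, Cm * ‖z w‖ < M * μ t ∧ σ w = σ t ∧ μ w = μ t := by
      intro w hw
      rcases hw.1.eq_or_lt with rfl | hlt
      · exact ⟨hsat, rfl, rfl⟩
      · obtain ⟨a1, a2, a3, -⟩ := hsub ⟨hlt, hw.2.trans_lt hs.2⟩
        exact ⟨a1, a2, by rw [hμ w (ht.trans hw.1), hμ t ht, a3]⟩
    obtain ⟨-, hσs, hμs⟩ := hall s ⟨hs.1.le, le_rfl⟩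
    have hfl : ⌊(s - T₀) / T⌋₊ = k := (hsub hs).2.2.2
    have hdec := hb.decay hq hK0 hK (i := σ t) hκ hμt hs.1.le ((hprim' s).mono ht le_rfl)
      (by
        filter_upwards [hg] with w hw hmem
        have := hw (ht.trans hmem.1)
        rwa [(hall w hmem).2.1, (hall w hmem).2.2] at this)
      (fun w hw => (hall w hw).1)
    rw [hσs, hμs, hfl]
    refine hdec.trans ?_
    have hμ2 : 0 ≤ μ t ^ 2 := by positivity
    refine max_le (mul_le_mul_of_nonneg_right (le_max_left _ _) hμ2) ?_
    have hst : 0 ≤ ρ * (s - t) := mul_nonneg hρ0.le (sub_nonneg.2 hs.1.le)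
    have hstep : h t k - ρ * (s - t) ≤ h s k := by
      simp only [h]
      rcases max_cases r₂ (r - ρ * (t - T₀ - k * T)) with ⟨e, -⟩ | ⟨e, -⟩
      · rw [e]
        exact (sub_le_self _ hst).trans (le_max_left _ _)
      · rw [e]
        refine le_trans (le_of_eq ?_) (le_max_right _ _)
        ring
    calc _ ≤ h t k * μ t ^ 2 - ρ * μ t ^ 2 * (s - t) := sub_le_sub_right hpt _
      _ = (h t k - ρ * (s - t)) * μ t ^ 2 := by ring
      _ ≤ h s k * μ t ^ 2 := mul_le_mul_of_nonneg_right hstep hμ2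

end ZoomingIn

/-! ### Observability -/

section Observability

variable {n p : ℕ}

theorem hasDerivAt_exp_smul_apply {E : Type*} [NormedAddCommGroup E] [NormedSpace ℝ E]
    [CompleteSpace E] (A : E →L[ℝ] E) (v : E) (t : ℝ) :
    HasDerivAt (fun u : ℝ => NormedSpace.exp (u • A) v) (A (NormedSpace.exp (t • A) v)) t :=
  (hasDerivAt_exp_smul_const' (𝕂 := ℝ) A t).clm_apply (hasDerivAt_const t v) |>.congr_deriv
    (by simp)

theorem continuous_exp_smul_apply {E : Type*} [NormedAddCommGroup E] [NormedSpace ℝ E]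
    [CompleteSpace E] (A : E →L[ℝ] E) (v : E) :
    Continuous fun u : ℝ => NormedSpace.exp (u • A) v :=
  continuous_iff_continuousAt.2 fun t => (hasDerivAt_exp_smul_apply A v t).continuousAt

theorem exp_zero_smul_apply {E : Type*} [NormedAddCommGroup E] [NormedSpace ℝ E]
    [CompleteSpace E] (A : E →L[ℝ] E) (v : E) : NormedSpace.exp ((0 : ℝ) • A) v = v := by
  have h : (0 : ℝ) • A = 0 := zero_smul ℝ A
  rw [h, NormedSpace.exp_zero]
  rfl

/-- Differentiating the vanishing output k times gives C Aᵏ e^{tA} v = 0 on [0, τ]; t = 0 gives the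
kernel of the observability matrix. -/
theorem IsObservable.eq_zero {C : Matrix (Fin p) (Fin n) ℝ} {A : Matrix (Fin n) (Fin n) ℝ}
    (h : IsObservable C A) {τ : ℝ} (hτ : 0 < τ) {v : EuclideanSpace ℝ (Fin n)}
    (hv : ∀ t ∈ Icc 0 τ, actL C (NormedSpace.exp (t • actL A) v) = 0) : v = 0 := by
  have key : ∀ k : ℕ, ∀ t ∈ Icc 0 τ,
      actL (C * A ^ k) (NormedSpace.exp (t • actL A) v) = 0 := by
    intro k
    induction k with
    | zero => simpa using hv
    | succ k ih =>
      intro t ht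
      have h1 : HasDerivWithinAt (fun u : ℝ => actL (C * A ^ k) (NormedSpace.exp (u • actL A) v))
          (actL (C * A ^ k) (actL A (NormedSpace.exp (t • actL A) v))) (Icc 0 τ) t :=
        ((actL (C * A ^ k)).hasFDerivAt.comp_hasDerivAt t
          (hasDerivAt_exp_smul_apply (actL A) v t)).hasDerivWithinAt
      have h2 : HasDerivWithinAt (fun u : ℝ => actL (C * A ^ k) (NormedSpace.exp (u • actL A) v))
          0 (Icc 0 τ) t :=
        (hasDerivWithinAt_const t (Icc 0 τ) 0).congr ih (ih t ht)
      have h3 := (uniqueDiffOn_Icc hτ t ht).eq_deriv _ h1 h2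
      rw [← h3, pow_succ, ← Matrix.mul_assoc, ← act_eq_actL, act_mul, act_eq_actL, act_eq_actL]
  have h0 : v.ofLp = 0 := h v.ofLp fun k _ => by
    have := key k 0 ⟨le_rfl, hτ.le⟩
    rw [exp_zero_smul_apply] at this
    exact congrArg WithLp.ofLp this
  exact (WithLp.ofLp_eq_zero 2).1 h0

/-- The initial state of an observable linear system is bounded by the output. -/
theorem IsObservable.exists_norm_le {C : Matrix (Fin p) (Fin n) ℝ} {A : Matrix (Fin n) (Fin n) ℝ}
    (h : IsObservable C A) {τ : ℝ} (hτ : 0 < τ) : ∃ γ, ∀ (v : EuclideanSpace ℝ (Fin n)) (β : ℝ),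
      0 ≤ β → (∀ t ∈ Icc 0 τ, ‖actL C (NormedSpace.exp (t • actL A) v)‖ ≤ β) → ‖v‖ ≤ γ * β := by
  let Φ : EuclideanSpace ℝ (Fin n) →ₗ[ℝ] C(Icc (0 : ℝ) τ, EuclideanSpace ℝ (Fin p)) :=
    { toFun := fun v => ⟨fun t => actL C (NormedSpace.exp ((t : ℝ) • actL A) v),
        (actL C).continuous.comp
          ((continuous_exp_smul_apply (actL A) v).comp continuous_subtype_val)⟩
      map_add' := fun v w => by
        ext1 t
        simp
      map_smul' := fun s v => by
        ext1 t
        simp }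
  have hker : LinearMap.ker Φ = ⊥ := by
    rw [LinearMap.ker_eq_bot']
    intro v hv
    exact h.eq_zero hτ fun t ht =>
      congrArg (fun f : C(Icc (0 : ℝ) τ, EuclideanSpace ℝ (Fin p)) => f ⟨t, ht⟩) hv
  -- An injective linear map on a finite-dimensional space is bounded below.
  obtain ⟨γ, -, hγ⟩ := Φ.exists_antilipschitzWith hker
  refine ⟨γ, fun v β hβ hv => ?_⟩
  have h1 : ‖v‖ ≤ γ * ‖Φ v‖ := by
    simpa using hγ.le_mul_dist v 0
  refine h1.trans (mul_le_mul_of_nonneg_left ?_ γ.2)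
  exact (ContinuousMap.norm_le _ hβ).2 fun t => hv t t.2

/-- The difference from the exponential solution starts at 0 and satisfies the same linear equation,
so Grönwall's inequality makes it vanish. -/
theorem IsPrimitiveOn.eq_exp {x g : ℝ → EuclideanSpace ℝ (Fin n)} {a b : ℝ}
    (h : IsPrimitiveOn x g a b) {A : Matrix (Fin n) (Fin n) ℝ}
    (hg : ∀ᵐ t, t ∈ Icc a b → g t = act A (x t)) {t : ℝ} (ht : t ∈ Icc a b) :
    x t = NormedSpace.exp ((t - a) • actL A) (x a) := by
  set y : ℝ → EuclideanSpace ℝ (Fin n) := fun s => NormedSpace.exp ((s - a) • actL A) (x a)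
  have hy : ∀ s, HasDerivAt y (actL A (y s)) s := fun s =>
    (hasDerivAt_exp_smul_apply (actL A) (x a) (s - a)).comp_sub_const s a
  have hyc : Continuous fun s => actL A (y s) :=
    (actL A).continuous.comp (continuous_iff_continuousAt.2 fun s => (hy s).continuousAt)
  have hya : y a = x a := by
    simp only [y, sub_self]
    exact exp_zero_smul_apply _ _
  have hprim : IsPrimitiveOn (fun s => x s - y s) (fun s => g s - actL A (y s)) a b := by
    intro s hs
    have hyi : IntervalIntegrable (fun s => actL A (y s)) volume a s := hyc.intervalIntegrable _ _
    refine ⟨(h s hs).1.sub hyi, ?_⟩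
    rw [intervalIntegral.integral_sub (h s hs).1 hyi,
      intervalIntegral.integral_eq_sub_of_hasDerivAt (fun r _ => hy r) hyi, ← h.sub_eq
        ⟨le_rfl, hs.1.trans hs.2⟩ hs]
    simp only [hya]
    abel
  have := hprim.norm_le (norm_nonneg (actL A)) (by
    filter_upwards [hg] with s hs hmem
    rw [hs hmem, act_eq_actL, ← map_sub]
    exact (actL A).le_opNorm _) ht
  simp only [hya, sub_self, norm_zero, zero_mul] at this
  exact sub_eq_zero.1 (norm_le_zero_iff.1 this)

end Observability

/-! ### The zooming-out stage -/

section ZoomingOut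

variable {ι : Type*} {n m p : ℕ}

/-- The zoom parameter on the `k`-th interval of length `τ` of the zooming-out stage, which
outgrows solutions with growth rate `a`. -/
def outGain (τ a : ℝ) (k : ℕ) : ℝ := (k + 1) * Real.exp (a * (τ * (k + 1)))

theorem outGain_pos (τ a : ℝ) (k : ℕ) : 0 < outGain τ a k := by
  unfold outGain
  positivity

theorem outGain_mono {τ a : ℝ} (hτ : 0 < τ) (ha : 0 ≤ a) : Monotone (outGain τ a) := by
  intro k l hkl
  unfold outGain
  gcongr

/-- On the `k`-th interval of length `τ` the mode is constant and the received signal `w` shows no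
saturation. -/
def Captures (τ a R : ℝ) (σ : ℝ → ι) (w : ℝ → EuclideanSpace ℝ (Fin p)) (k : ℕ) : Prop :=
  (∀ s ∈ Icc (k * τ) ((k + 1) * τ), σ s = σ (k * τ)) ∧
    ∀ s ∈ Ico (k * τ) ((k + 1) * τ), ‖w s‖ ≤ R * outGain τ a k

/-- Capture on interval k can be decided by time (k + 1)τ from σ on the closed and w on the
half-open interval, which is the information that causality allows. -/
theorem Captures.congr {τ a R : ℝ} {σ σ' : ℝ → ι} {w w' : ℝ → EuclideanSpace ℝ (Fin p)} {k : ℕ}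
    (hτ : 0 < τ) (h : Captures τ a R σ w k)
    (hσ : ∀ s ∈ Icc 0 ((k + 1) * τ), σ s = σ' s) (hw : ∀ s ∈ Ico 0 ((k + 1) * τ), w s = w' s) :
    Captures τ a R σ' w' k := by
  have h0 : 0 ≤ k * τ := by positivity
  refine ⟨fun s hs => ?_, fun s hs => ?_⟩
  · rw [← hσ s ⟨h0.trans hs.1, hs.2⟩, ← hσ (k * τ) ⟨h0, by linarith⟩]
    exact h.1 s hs
  · rw [← hw s ⟨h0.trans hs.1, hs.2⟩]
    exact h.2 s hs

open scoped Classical in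
/-- Zoom out until the quantizer is not saturated during an interval without switches; then start
the zooming-in stage with the zero estimate and a proportional zoom parameter. -/
def zoomOutStrategy (ι : Type*) (n p : ℕ) (a R : ℝ) {τ G : ℝ} (hτ : 0 < τ) (ha : 0 ≤ a)
    (hG : 0 < G) : ZoomStrategy ι n p where
  out t := outGain τ a ⌊t / τ⌋₊
  out_pos t _ := outGain_pos τ a _
  out_mono s _ t _ hst := outGain_mono hτ ha (Nat.floor_mono (by gcongr))
  out_piecewise := isPiecewiseConstant_floor (outGain τ a) hτ
  endTime σ w := if h : ∃ k, Captures τ a R σ w k then (((Nat.find h + 1) * τ : ℝ) : WithTop ℝ)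
    else ⊤
  est _ _ := 0
  -- G turns the last gain into a bound on the state at the end time. The value 1 is never used,
  -- since then the end time is ⊤.
  init σ w := if h : ∃ k, Captures τ a R σ w k then G * outGain τ a (Nat.find h) else 1
  endTime_nonneg σ w := by
    split_ifs
    · exact WithTop.coe_nonneg.2 (by positivity)
    · exact le_top
  init_pos σ w := by
    split_ifs
    · exact mul_pos hG (outGain_pos τ a _)
    · exact one_pos
  causal σ σ' w w' t ht hσ hw := by
    by_cases h : ∃ k, Captures τ a R σ w k
    · rw [dif_pos h, WithTop.coe_inj] at ht
      have hsub : ∀ j : ℕ, j ≤ Nat.find h → ((j : ℝ) + 1) * τ ≤ t := fun j hj => by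
        rw [← ht]
        gcongr
      have hcap : Captures τ a R σ' w' (Nat.find h) := (Nat.find_spec h).congr hτ
        (fun s hs => hσ s ⟨hs.1, hs.2.trans (hsub _ le_rfl)⟩)
        (fun s hs => hw s ⟨hs.1, hs.2.trans_le (hsub _ le_rfl)⟩)
      have h' : ∃ k, Captures τ a R σ' w' k := ⟨_, hcap⟩
      -- Minimality transfers as well: an earlier capture for σ', w' would be one for σ, w.
      have hfind : Nat.find h' = Nat.find h := by
        rw [Nat.find_eq_iff]
        refine ⟨hcap, fun j hj hcj => Nat.find_min h hj (hcj.congr hτ ?_ ?_)⟩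
        · exact fun s hs => (hσ s ⟨hs.1, hs.2.trans (hsub _ hj.le)⟩).symm
        · exact fun s hs => (hw s ⟨hs.1, hs.2.trans_le (hsub _ hj.le)⟩).symm
      rw [dif_pos h', dif_pos h', dif_pos h, hfind, ht]
      exact ⟨rfl, rfl, rfl⟩
    · rw [dif_neg h] at ht
      exact absurd ht (WithTop.top_ne_coe)

variable {a R τ G : ℝ} {hτ : 0 < τ} {ha : 0 ≤ a} {hG : 0 < G}

theorem zoomOutStrategy_endTime_eq {σ : ℝ → ι} {w : ℝ → EuclideanSpace ℝ (Fin p)} {T₀ : ℝ}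
    (h : (zoomOutStrategy ι n p a R hτ ha hG).endTime σ w = T₀) :
    ∃ k : ℕ, T₀ = (k + 1) * τ ∧ Captures τ a R σ w k ∧
      (zoomOutStrategy ι n p a R hτ ha hG).init σ w = G * outGain τ a k := by
  classical
  by_cases hex : ∃ k, Captures τ a R σ w k
  · simp only [zoomOutStrategy, dif_pos hex, WithTop.coe_inj] at h ⊢
    exact ⟨Nat.find hex, h.symm, Nat.find_spec hex, rfl⟩
  · simp only [zoomOutStrategy, dif_neg hex] at h
    exact absurd h WithTop.top_ne_coe

/-- The hypothesis is conditional because a run follows the zooming-out gain only until the stage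
ends; if it has not ended by (k + 1)τ, interval k captures and ends it. -/
theorem zoomOutStrategy_exists_endTime {σ : ℝ → ι} {w : ℝ → EuclideanSpace ℝ (Fin p)} {k : ℕ}
    (h : (((k + 1) * τ : ℝ) : WithTop ℝ) < (zoomOutStrategy ι n p a R hτ ha hG).endTime σ w →
      Captures τ a R σ w k) :
    ∃ j ≤ k, (zoomOutStrategy ι n p a R hτ ha hG).endTime σ w = (((j + 1) * τ : ℝ) : WithTop ℝ) ∧
      (zoomOutStrategy ι n p a R hτ ha hG).init σ w = G * outGain τ a j := by
  classical
  by_cases hex : ∃ k, Captures τ a R σ w k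
  · simp only [zoomOutStrategy, dif_pos hex, WithTop.coe_lt_coe] at h ⊢
    refine ⟨Nat.find hex, ?_, rfl, rfl⟩
    by_contra! hlt
    have h1 : ((k : ℝ) + 1) * τ < (Nat.find hex + 1) * τ := by gcongr
    exact absurd (Nat.find_le (h := hex) (h1 |> h)) (not_le.2 hlt)
  · simp only [zoomOutStrategy, dif_neg hex] at h
    exact absurd ⟨k, h (WithTop.coe_lt_top _)⟩ hex

variable {sys : SwitchedSystem ι n m p}
  {q : EuclideanSpace ℝ (Fin p) → EuclideanSpace ℝ (Fin p)} {M Δ Ω T : ℝ} {c : ι → ι → ℝ}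
  {σ : ℝ → ι} {z : ℝ → ZSpace n} {μ : ℝ → ℝ}

theorem IsRun.norm_stateOf_le {S : ZoomStrategy ι n p} (hrun : IsRun sys q S Ω T c σ z μ)
    (hA : ∀ i v, ‖act (sys.A i) v‖ ≤ a * ‖v‖) (ha : 0 ≤ a) {t : ℝ} (ht0 : 0 ≤ t)
    (ht : (t : WithTop ℝ) ≤ S.endTime σ (received sys q σ z μ)) :
    ‖stateOf (z t)‖ ≤ ‖stateOf (z 0)‖ * Real.exp (a * t) := by
  obtain ⟨g, hprim, hg⟩ := hrun.state_out.exists_isPrimitiveOn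
  have hsub : Icc 0 t ⊆ {t : ℝ | 0 ≤ t ∧ (t : WithTop ℝ) ≤
      S.endTime σ (received sys q σ z μ)} := fun s hs =>
    ⟨hs.1, (WithTop.coe_le_coe.2 hs.2).trans ht⟩
  have := (hprim t hsub).norm_le ha (by
    filter_upwards [hg] with s hs hmem
    rw [mem_singleton_iff.1 (hs (hsub hmem))]
    exact hA _ _) (right_mem_Icc.2 ht0)
  simpa using this

/-- The zooming-out stage ends within a time that depends only on the chatter bound and on a bound
for the initial state. -/
theorem IsRun.exists_endTime_eq {τa N₀ Δ₀ Cx : ℝ} (hτa : 0 < τa) (hττ : τ = τa / 2)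
    (hrun : IsRun sys q (zoomOutStrategy ι n p a R hτ ha hG) Ω T c σ z μ)
    (hσ : IsPiecewiseConstant σ) (hadt : HasAverageDwellTime σ τa N₀)
    (hA : ∀ i v, ‖act (sys.A i) v‖ ≤ a * ‖v‖) (hCx : 0 ≤ Cx)
    (hC : ∀ i v, ‖act (sys.C i) v‖ ≤ Cx * ‖v‖) (hR : 0 ≤ R)
    (hΔ₀ : ∀ y, ‖y‖ ≤ Δ₀ → q y = 0) {K N : ℕ}
    (hK : Cx * ‖stateOf (z 0)‖ ≤ Δ₀ * (K + 1)) (hN : 2 * N₀ < N) (hN0 : 0 < N) :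
    ∃ j < K + N, (zoomOutStrategy ι n p a R hτ ha hG).endTime σ (received sys q σ z μ) =
        (((j + 1) * τ : ℝ) : WithTop ℝ) ∧
      (zoomOutStrategy ι n p a R hτ ha hG).init σ (received sys q σ z μ) = G * outGain τ a j := by
  obtain ⟨k, hKk, hkN, hno⟩ := hadt.exists_no_switch hσ hτa K N hN hN0
  rw [← hττ] at hno
  have h0k : 0 ≤ (k : ℝ) * τ := by positivity
  obtain ⟨j, hj, h1, h2⟩ := zoomOutStrategy_exists_endTime (hτ := hτ) (ha := ha) (hG := hG)
    (n := n) (R := R) (σ := σ) (w := received sys q σ z μ) (k := k) (fun hlt => by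
    refine ⟨hσ.eq_of_no_switch h0k hno, fun s hs => ?_⟩
    have hs0 : 0 ≤ s := h0k.trans hs.1
    have hsE : (s : WithTop ℝ) < (zoomOutStrategy ι n p a R hτ ha hG).endTime σ
        (received sys q σ z μ) := (WithTop.coe_lt_coe.2 hs.2).trans hlt
    have hfl : ⌊s / τ⌋₊ = k := by
      rw [Nat.floor_eq_iff (by positivity), le_div_iff₀ hτ, div_lt_iff₀ hτ]
      exact hs
    have hμ : μ s = outGain τ a k := by
      rw [hrun.zoom_out s hs0 hsE, ← hfl]
      rfl
    have hx := hrun.norm_stateOf_le hA ha hs0 hsE.le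
    -- The exponential in the gain absorbs the growth of x up to the end of the interval, and the
    -- factor k + 1 ≥ K + 1 absorbs the size of x(0). The output then lies where q_μ vanishes.
    have hy : ‖sys.output (σ s) (z s)‖ ≤ Δ₀ * outGain τ a k := by
      have hΔK : 0 ≤ Δ₀ * (K + 1) := le_trans (by positivity) hK
      have hΔ₀0 : 0 ≤ Δ₀ := nonneg_of_mul_nonneg_left hΔK (by positivity)
      calc ‖sys.output (σ s) (z s)‖ ≤ Cx * ‖stateOf (z s)‖ := hC _ _
        _ ≤ Cx * (‖stateOf (z 0)‖ * Real.exp (a * s)) := by gcongr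
        _ = (Cx * ‖stateOf (z 0)‖) * Real.exp (a * s) := by ring
        _ ≤ (Δ₀ * (K + 1)) * Real.exp (a * (τ * (k + 1))) := by
            have := hs.2.le
            gcongr
            linarith
        _ ≤ (Δ₀ * (k + 1)) * Real.exp (a * (τ * (k + 1))) := by gcongr
        _ = Δ₀ * outGain τ a k := by
            unfold outGain
            ring
    have hg0 := outGain_pos τ a k
    have hw : received sys q σ z μ s = 0 := by
      rw [received, hμ, zoomed, hΔ₀ _ ((norm_inv_smul_le_iff hg0 _).2 hy), smul_zero]
    rw [hw, norm_zero]
    positivity)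
  exact ⟨j, hj.trans_lt hkN, h1, h2⟩

/-- At the end of the zooming-out stage the state is bounded by a multiple of the zoom parameter. -/
theorem IsRun.norm_stateOf_endTime_le {γ : ℝ} (hq : IsQuantizer q M Δ)
    (hrun : IsRun sys q (zoomOutStrategy ι n p a (M - Δ) hτ ha hG) Ω T c σ z μ)
    (hA : ∀ i v, ‖act (sys.A i) v‖ ≤ a * ‖v‖)
    (hγ : ∀ i (v : EuclideanSpace ℝ (Fin n)) (β : ℝ), 0 ≤ β →
      (∀ t ∈ Icc 0 (τ / 2), ‖actL (sys.C i) (NormedSpace.exp (t • actL (sys.A i)) v)‖ ≤ β) →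
        ‖v‖ ≤ γ * β) {T₀ : ℝ}
    (hT₀ : (zoomOutStrategy ι n p a (M - Δ) hτ ha hG).endTime σ (received sys q σ z μ) = T₀) :
    G * ‖stateOf (z T₀)‖ ≤ γ * M * Real.exp (a * τ) *
      (zoomOutStrategy ι n p a (M - Δ) hτ ha hG).init σ (received sys q σ z μ) := by
  obtain ⟨k, hTk, hcap, hinit⟩ := zoomOutStrategy_endTime_eq hT₀
  have hM : 0 < M := hq.pos.trans hq.lt
  have hg0 := outGain_pos τ a k
  have h0k : 0 ≤ (k : ℝ) * τ := by positivity
  obtain ⟨g, hprim, hg⟩ := hrun.state_out.exists_isPrimitiveOn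
  rw [hT₀] at hprim hg
  have hsub : ∀ s ∈ Icc (k * τ) T₀, 0 ≤ s ∧ (s : WithTop ℝ) ≤ T₀ := fun s hs =>
    ⟨h0k.trans hs.1, WithTop.coe_le_coe.2 hs.2⟩
  have hprim' : IsPrimitiveOn (fun t => stateOf (z t)) g (k * τ) T₀ :=
    (hprim T₀ fun s hs => ⟨hs.1, WithTop.coe_le_coe.2 hs.2⟩).mono h0k le_rfl
  set i := σ (k * τ)
  have hg' : ∀ᵐ t, t ∈ Icc (k * τ) T₀ → g t = act (sys.A i) (stateOf (z t)) := by
    filter_upwards [hg] with s hs hmem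
    rw [mem_singleton_iff.1 (hs (hsub s hmem)), hcap.1 s (hTk ▸ hmem)]
  have hv : ‖stateOf (z (k * τ))‖ ≤ γ * (M * outGain τ a k) := by
    refine hγ i _ _ (by positivity) fun t ht => ?_
    -- Observing only for time τ/2 keeps the closed observation window inside the half-open interval
    -- on which data are received.
    have hs : k * τ + t ∈ Ico (k * τ) ((k + 1) * τ) := ⟨by linarith [ht.1], by linarith [ht.2]⟩
    have hs' : k * τ + t ∈ Icc (k * τ) T₀ := ⟨hs.1, hTk ▸ hs.2.le⟩
    have hx := hprim'.eq_exp hg' hs'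
    rw [add_sub_cancel_left] at hx
    rw [← hx, ← act_eq_actL, show i = σ (k * τ + t) from (hcap.1 _ (Ico_subset_Icc_self hs)).symm]
    have hsE : ((k * τ + t : ℝ) : WithTop ℝ) < (zoomOutStrategy ι n p a (M - Δ) hτ ha hG).endTime σ
        (received sys q σ z μ) := by
      rw [hT₀, hTk]
      exact WithTop.coe_lt_coe.2 hs.2
    have hs0 : 0 ≤ k * τ + t := h0k.trans hs.1
    have hfl : ⌊(k * τ + t) / τ⌋₊ = k := by
      rw [Nat.floor_eq_iff (by positivity), le_div_iff₀ hτ, div_lt_iff₀ hτ]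
      exact hs
    have hμ : μ (k * τ + t) = outGain τ a k := by
      rw [hrun.zoom_out _ hs0 hsE]
      change outGain τ a ⌊(k * τ + t) / τ⌋₊ = _
      rw [hfl]
    have hw := hcap.2 _ hs
    rw [received, hμ] at hw
    exact hq.norm_le_of_zoomed_le hg0 hw
  have hkT : (k : ℝ) * τ ≤ T₀ := by
    rw [hTk]
    linarith
  have hend := hprim'.norm_le ha (by
    filter_upwards [hg'] with s hs hmem
    rw [hs hmem]
    exact hA _ _) (right_mem_Icc.2 hkT)
  have hlen : T₀ - k * τ = τ := by
    rw [hTk]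
    ring
  rw [hlen] at hend
  rw [hinit]
  calc G * ‖stateOf (z T₀)‖ ≤ G * (γ * (M * outGain τ a k) * Real.exp (a * τ)) := by
        refine mul_le_mul_of_nonneg_left (hend.trans ?_) hG.le
        gcongr
    _ = _ := by ring

end ZoomingOut

/-! ### Stabilization -/

section Stabilization

theorem norm_le_two_mul_of_observerOf_eq_zero {n : ℕ} {z : ZSpace n} (h : observerOf z = 0) :
    ‖z‖ ≤ 2 * ‖stateOf z‖ := by
  refine le_of_sq_le_sq ?_ (by positivity)
  rw [norm_sq_of_observerOf_eq_zero h]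
  nlinarith [sq_nonneg ‖stateOf z‖]

/-- The strict inequalities on the parameters leave room for a slightly smaller `κ`. -/
theorem exists_strict_margin {lP LP lQ B Cm M κ Ω T : ℝ} (hlP : 0 < lP) (hLP : 0 < LP)
    (hlQ : 0 < lQ) (hB : 0 < B) (hCm : 0 < Cm) (hM : 0 < M) (hκ : 0 < κ)
    (hΩ : Ω ^ 2 = LP / lP * (B * (1 + κ) * Cm / M) ^ 2)
    (hT : (lP * M ^ 2 - LP * (B * (1 + κ) * Cm) ^ 2) / (lQ * κ * (1 + κ) * (B * Cm) ^ 2) < T) :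
    ∃ κ' r, 0 < κ' ∧ 0 < r ∧ r * Ω ^ 2 = LP * (B * (1 + κ')) ^ 2 ∧ r * Cm ^ 2 < lP * M ^ 2 ∧
      r - lQ * κ' * (1 + κ') * B ^ 2 * T ≤ LP * (B * (1 + κ')) ^ 2 := by
  have hΩ0 : 0 < Ω ^ 2 := by
    rw [hΩ]
    positivity
  set φ : ℝ → ℝ := fun x =>
    LP * (B * (1 + x)) ^ 2 / Ω ^ 2 - lQ * x * (1 + x) * B ^ 2 * T - LP * (B * (1 + x)) ^ 2
  have hφκ : φ κ < 0 := by
    rw [div_lt_iff₀ (by positivity)] at hT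
    -- At κ itself r would equal lP M²/Cm², with no margin against saturation. The condition on T is
    -- strict and survives a small decrease of κ, which makes r smaller.
    have h1 : LP * (B * (1 + κ)) ^ 2 / Ω ^ 2 = lP * M ^ 2 / Cm ^ 2 := by
      rw [hΩ]
      field_simp
    have h2 : Cm ^ 2 * φ κ < 0 := by
      simp only [φ]
      rw [h1]
      have h3 : Cm ^ 2 * (lP * M ^ 2 / Cm ^ 2) = lP * M ^ 2 := by field_simp
      rw [mul_sub, mul_sub, h3]
      linarith
    exact neg_of_mul_neg_right h2 (by positivity)
  have hφc : Continuous φ := by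
    simp only [φ]
    fun_prop
  have hev : ∀ᶠ x in 𝓝[<] κ, φ x < 0 :=
    ((hφc.tendsto κ).mono_left nhdsWithin_le_nhds).eventually_lt_const hφκ
  obtain ⟨κ', h1, h2⟩ := (hev.and (Ioo_mem_nhdsLT hκ)).exists
  have hκ' : 0 < κ' := h2.1
  refine ⟨κ', LP * (B * (1 + κ')) ^ 2 / Ω ^ 2, hκ', by positivity,
    div_mul_cancel₀ _ hΩ0.ne', ?_, ?_⟩
  · have h3 : LP * (B * (1 + κ')) ^ 2 / Ω ^ 2 * Cm ^ 2 =
        lP * M ^ 2 * ((1 + κ') / (1 + κ)) ^ 2 := by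
      rw [hΩ]
      field_simp
    rw [h3]
    refine mul_lt_of_lt_one_right (by positivity) (pow_lt_one₀ (by positivity) ?_ two_ne_zero)
    rw [div_lt_one (by positivity)]
    linarith [h2.2]
  · simp only [φ] at h1
    linarith

theorem exists_uniform_bound {ι : Type*} [Finite ι] (f : ι → ℝ) : ∃ b > 0, ∀ i, f i ≤ b := by
  obtain ⟨b, hb⟩ := (finite_range f).bddAbove
  exact ⟨max b 1, lt_max_of_lt_right one_pos,
    fun i => (hb (mem_range_self i)).trans (le_max_left _ _)⟩

variable {ι : Type*} {n m p : ℕ} {sys : SwitchedSystem ι n m p}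
  {q : EuclideanSpace ℝ (Fin p) → EuclideanSpace ℝ (Fin p)} {M Δ : ℝ}
  {P Q : ι → Matrix (Fin n ⊕ Fin n) (Fin n ⊕ Fin n) ℝ} {lP LP lQ Θ Cm : ℝ}

set_option maxHeartbeats 400000 in
/-- The zooming strategy stabilizes the switched system under the explicit conditions on the
parameters. -/
theorem LyapunovBounds.stabilizes [Finite ι] (hb : LyapunovBounds sys P Q lP LP lQ Θ Cm)
    (hobs : ∀ i, IsObservable (sys.C i) (sys.A i)) (hq : IsQuantizer q M Δ)
    {κ Ω T τa cb : ℝ} {c : ι → ι → ℝ} (hκ : 0 < κ) (hΩ0 : 0 < Ω) (hΩ1 : Ω < 1) (hT0 : 0 < T)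
    (hΩ : Ω ^ 2 = LP / lP * (Θ * Δ * (1 + κ) * Cm / M) ^ 2)
    (hT : (lP * M ^ 2 - LP * (Θ * Δ * (1 + κ) * Cm) ^ 2) /
      (lQ * κ * (1 + κ) * (Θ * Δ * Cm) ^ 2) < T)
    (hc : ∀ i j, i ≠ j → 0 < c j i)
    (hcP : ∀ i j, i ≠ j → ∀ z : ZSpace n,
      inner ℝ (act (P j) z) z ≤ c j i * inner ℝ (act (P i) z) z)
    (hcb : ∀ i j, i ≠ j → c j i ≤ cb) (hcb1 : 1 ≤ cb) (hτa : 0 < τa)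
    (hτ : Real.log cb / (2 * Real.log (1 / Ω)) * T < τa) : Stabilizes sys q Ω T c τa := by
  have hΘ := hb.Θ_pos
  have hΔ := hq.pos
  have hM : 0 < M := hΔ.trans hq.lt
  have hlP := hb.lP_pos
  have hLP := hb.LP_pos
  obtain ⟨κ', r, hκ', hr0, hrΩ, hrM, hrT⟩ := exists_strict_margin hlP hLP hb.lQ_pos
    (mul_pos hΘ hΔ) hb.Cm_pos hM hκ hΩ hT
  obtain ⟨K, hK0, hK⟩ := exists_norm_field_le sys hq
  obtain ⟨a, ha0, haA⟩ := exists_uniform_bound fun i => opNorm (sys.A i)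
  obtain ⟨Cx, hCx0, hCxC⟩ := exists_uniform_bound fun i => opNorm (sys.C i)
  have hA : ∀ i v, ‖act (sys.A i) v‖ ≤ a * ‖v‖ := fun i v =>
    (norm_act_le _ _).trans (mul_le_mul_of_nonneg_right (haA i) (norm_nonneg _))
  have hC : ∀ i v, ‖act (sys.C i) v‖ ≤ Cx * ‖v‖ := fun i v =>
    (norm_act_le _ _).trans (mul_le_mul_of_nonneg_right (hCxC i) (norm_nonneg _))
  set τ : ℝ := τa / 2 with hττ
  have hτ0 : 0 < τ := half_pos hτa
  choose γ' hγ' using fun i => (hobs i).exists_norm_le (half_pos hτ0)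
  obtain ⟨γ, hγ0, hγle⟩ := exists_uniform_bound γ'
  have hγ : ∀ i (v : EuclideanSpace ℝ (Fin n)) (β : ℝ), 0 ≤ β →
      (∀ t ∈ Icc 0 (τ / 2), ‖actL (sys.C i) (NormedSpace.exp (t • actL (sys.A i)) v)‖ ≤ β) →
        ‖v‖ ≤ γ * β := fun i v β hβ h =>
    (hγ' i v β hβ h).trans (mul_le_mul_of_nonneg_right (hγle i) hβ)
  obtain ⟨Δ₀, hΔ₀0, hΔ₀⟩ := hq.near_zero
  -- With ξ = 0 one has ‖z‖² = 2‖x‖², so this G yields V(T₀) ≤ 2λ̄_P‖x‖² ≤ rμ(T₀)².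
  set G : ℝ := γ * M * Real.exp (a * τ) * √(2 * LP / r) with hG
  have hG0 : 0 < G := by positivity
  set S : ZoomStrategy ι n p := zoomOutStrategy ι n p a (M - Δ) hτ0 ha0.le hG0 with hS
  have hMΔ : 0 ≤ M - Δ := sub_nonneg.2 hq.lt.le
  set rate : ℝ := Real.log (1 / Ω) / T - Real.log cb / (2 * τa) with hrate
  -- Positivity of the rate is the dwell-time condition `hτ` rearranged.
  have hrate0 : 0 < rate := by
    have hlogΩ : 0 < Real.log (1 / Ω) := Real.log_pos (by rw [lt_div_iff₀ hΩ0]; linarith)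
    rw [hrate, sub_pos, div_lt_div_iff₀ (by positivity) hT0]
    rw [div_mul_eq_mul_div, div_lt_iff₀ (by positivity)] at hτ
    linarith
  set D : ℝ := √(r / lP) with hD
  have hD0 : 0 < D := by positivity
  -- facts that hold along every run once the zooming-in stage has started
  have hin : ∀ {N₀ : ℝ} {σ : ℝ → ι} {z : ℝ → ZSpace n} {μ : ℝ → ℝ}, IsPiecewiseConstant σ →
      HasAverageDwellTime σ τa N₀ → IsRun sys q S Ω T c σ z μ → ∀ {T₀ : ℝ},
      S.endTime σ (received sys q σ z μ) = T₀ → 0 ≤ T₀ ∧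
      (∀ t, T₀ < t → ‖z t‖ ≤ D * (S.init σ (received sys q σ z μ) *
        Real.exp (Real.log (1 / Ω) + Real.log cb * N₀ / 2) * Real.exp (-rate * (t - T₀)))) ∧
      (∀ t, T₀ ≤ t → ‖z t‖ ≤ ‖z T₀‖ * Real.exp (K * (t - T₀))) ∧
      observerOf (z T₀) = 0 := by
    intro N₀ σ z μ hσ hadt hrun T₀ hT₀
    have hT₀0 : 0 ≤ T₀ := by
      have := S.endTime_nonneg σ (received sys q σ z μ)
      rw [hT₀] at this
      exact WithTop.coe_nonneg.1 this
    have hobs0 : observerOf (z T₀) = 0 := hrun.observer_reset T₀ hT₀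
    set μ₀ := S.init σ (received sys q σ z μ) with hμ₀
    have hμ₀0 : 0 < μ₀ := S.init_pos _ _
    have hμ := hrun.zoom_in T₀ hT₀
    have hsol := hrun.state_in T₀ hT₀
    have hstart : inner ℝ (act (P (σ T₀)) (z T₀)) (z T₀) ≤ r * μ₀ ^ 2 := by
      have h1 : G * ‖stateOf (z T₀)‖ ≤ γ * M * Real.exp (a * τ) * μ₀ :=
        hrun.norm_stateOf_endTime_le hq hA hγ hT₀
      have h2 : √(2 * LP / r) * ‖stateOf (z T₀)‖ ≤ μ₀ := by
        have h3 : 0 < γ * M * Real.exp (a * τ) := by positivity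
        rw [hG, mul_assoc] at h1
        exact le_of_mul_le_mul_left h1 h3
      have h4 : 2 * LP / r * ‖stateOf (z T₀)‖ ^ 2 ≤ μ₀ ^ 2 := by
        have := pow_le_pow_left₀ (by positivity) h2 2
        rwa [mul_pow, Real.sq_sqrt (by positivity)] at this
      rw [div_mul_eq_mul_div, div_le_iff₀ hr0] at h4
      refine (hb.P_upper _ _).trans ?_
      rw [norm_sq_of_observerOf_eq_zero hobs0]
      linarith
    have hinv := hb.zoomIn_invariant hq hK0 hK hκ' hΩ0 hΩ1 hT0 hc hcP hrΩ hrM hrT hσ hT₀0 hμ₀0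
      hμ hsol hstart
    have hμpos : ∀ t, T₀ ≤ t → 0 < μ t := fun t ht =>
      hμ t ht ▸ zoomIn_pos hσ hΩ0 hc hμ₀0 t
    refine ⟨hT₀0, fun t ht => ?_, fun t ht => ?_, hobs0⟩
    · have h1 : ‖z t‖ ≤ D * μ t := by
        refine le_of_sq_le_sq ?_ (mul_nonneg hD0.le (hμpos t ht.le).le)
        rw [mul_pow, hD, Real.sq_sqrt (by positivity), div_mul_eq_mul_div,
          le_div_iff₀ hlP, mul_comm]
        exact (hb.P_lower _ _).trans (hinv t ht.le)
      refine h1.trans (mul_le_mul_of_nonneg_left ?_ hD0.le)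
      rw [hμ t ht.le]
      exact zoomIn_le hσ hadt hΩ0 hΩ1 hT₀0 hμ₀0 hc hcb hcb1 ht
    · obtain ⟨g, hprim, hg⟩ := hsol.exists_isPrimitiveOn
      refine (hprim t fun s hs => hs.1).norm_le hK0 ?_ (right_mem_Icc.2 ht)
      filter_upwards [hg] with s hs hmem
      exact norm_le_of_mem_filippov_field (hK _ _ (hμpos s hmem.1)) (hs hmem.1)
  refine ⟨S, fun N₀ hN₀ => ⟨fun σ z μ hσ hadt hrun => ?_, fun ε hε => ?_⟩⟩
  · obtain ⟨k, hk⟩ := exists_nat_ge (Cx * ‖stateOf (z 0)‖ / Δ₀)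
    obtain ⟨N, hN⟩ := exists_nat_gt (2 * N₀)
    have hN0 : 0 < N := by
      have : (0 : ℝ) < N := by linarith
      exact_mod_cast this
    obtain ⟨j, -, hend, -⟩ := hrun.exists_endTime_eq (K := k) hτa hττ hσ hadt hA hCx0.le hC hMΔ hΔ₀
      (by
        rw [div_le_iff₀ hΔ₀0] at hk
        linarith) hN hN0
    obtain ⟨hT₀0, hdecay, -, -⟩ := hin hσ hadt hrun hend
    have hμ := hrun.zoom_in _ hend
    have hμout : ∀ t : ℝ, 0 ≤ t → t < (j + 1) * τ → μ t = S.out t := fun t ht0 ht =>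
      hrun.zoom_out t ht0 (by rw [hend]; exact WithTop.coe_lt_coe.2 ht)
    refine ⟨⟨_, hend⟩, ?_, fun t ht => ?_, ?_⟩
    · exact isPiecewiseConstant_of_eq_zoomIn hσ hΩ0 hc hT0 hT₀0 S.out_piecewise hμout hμ
    · rcases lt_or_ge t ((j + 1) * τ) with h | h
      · rw [hμout t ht h]
        exact S.out_pos t ht
      · rw [hμ t h]
        exact zoomIn_pos hσ hΩ0 hc (S.init_pos _ _) t
    · rw [tendsto_zero_iff_norm_tendsto_zero]
      have hlim : Tendsto (fun t : ℝ => D * (S.init σ (received sys q σ z μ) *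
          Real.exp (Real.log (1 / Ω) + Real.log cb * N₀ / 2) *
            Real.exp (-rate * (t - (j + 1) * τ)))) atTop (𝓝 0) := by
        have h1 : Tendsto (fun t : ℝ => Real.exp (-rate * (t - (j + 1) * τ))) atTop (𝓝 0) := by
          refine Real.tendsto_exp_atBot.comp ?_
          exact (tendsto_atTop_add_const_right _ _ tendsto_id).const_mul_atTop_of_neg
            (neg_lt_zero.2 hrate0)
        simpa using (h1.const_mul _).const_mul D
      refine squeeze_zero' (Eventually.of_forall fun t => norm_nonneg _) ?_ hlim
      filter_upwards [eventually_gt_atTop (((j : ℝ) + 1) * τ)] with t ht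
      exact hdecay t ht
  · obtain ⟨N, hN⟩ := exists_nat_gt (2 * N₀)
    have hN0 : 0 < N := by
      have : (0 : ℝ) < N := by linarith
      exact_mod_cast this
    -- For small x(0) the end index is below N, so E bounds the prefactor of the decay estimate
    -- uniformly over runs.
    set E : ℝ := D * (G * outGain τ a N * Real.exp (Real.log (1 / Ω) + Real.log cb * N₀ / 2))
    have hgN := outGain_pos τ a N
    have hE0 : 0 < E := by positivity
    obtain ⟨s, hs0, hs⟩ : ∃ s, 0 < s ∧ E * Real.exp (-rate * s) < ε := by
      have hlim : Tendsto (fun s : ℝ => E * Real.exp (-rate * s)) atTop (𝓝 0) := by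
        have h1 : Tendsto (fun s : ℝ => Real.exp (-rate * s)) atTop (𝓝 0) :=
          Real.tendsto_exp_atBot.comp (tendsto_id.const_mul_atTop_of_neg (neg_lt_zero.2 hrate0))
        simpa using h1.const_mul E
      exact ((eventually_gt_atTop 0).and (hlim.eventually_lt_const hε)).exists
    set A₀ : ℝ := 2 * Real.exp (a * (N * τ)) * Real.exp (K * s) with hA₀
    have hA₀0 : 0 < A₀ := by positivity
    -- The first bound allows K = 0, hence T₀ ≤ Nτ; the second controls z up to T₀ + s by growth
    -- estimates alone.
    refine ⟨min (Δ₀ / Cx) (ε / A₀), by positivity, fun σ z μ hσ hadt hrun hx0 t ht => ?_⟩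
    have hx1 : Cx * ‖stateOf (z 0)‖ ≤ Δ₀ := by
      have := (lt_div_iff₀ hCx0).1 (hx0.trans_le (min_le_left _ _))
      linarith
    have hx2 : ‖stateOf (z 0)‖ * A₀ < ε := (lt_div_iff₀ hA₀0).1 (hx0.trans_le (min_le_right _ _))
    obtain ⟨j, hjN, hend, hinit⟩ := hrun.exists_endTime_eq (K := 0) hτa hττ hσ hadt hA hCx0.le hC
      hMΔ hΔ₀ (by simpa using hx1) hN hN0
    rw [zero_add] at hjN
    obtain ⟨hT₀0, hdecay, hgrow, hobs0⟩ := hin hσ hadt hrun hend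
    set T₀ : ℝ := (j + 1) * τ with hT₀
    have hT₀N : T₀ ≤ N * τ := by
      have : (j : ℝ) + 1 ≤ N := by exact_mod_cast hjN
      rw [hT₀]
      gcongr
    have hout : ∀ t, 0 ≤ t → t ≤ T₀ → observerOf (z t) = 0 →
        ‖z t‖ ≤ 2 * (‖stateOf (z 0)‖ * Real.exp (a * (N * τ))) := by
      intro t ht htT hobs
      have h1 := hrun.norm_stateOf_le hA ha0.le ht (by rw [hend]; exact WithTop.coe_le_coe.2 htT)
      refine (norm_le_two_mul_of_observerOf_eq_zero hobs).trans ?_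
      refine mul_le_mul_of_nonneg_left (h1.trans ?_) two_pos.le
      have := htT.trans hT₀N
      gcongr
    have hexp1 : 1 ≤ Real.exp (K * s) := Real.one_le_exp (by positivity)
    rcases lt_or_ge t T₀ with h1 | h1
    · have hobs := hrun.observer_out t ht (by rw [hend]; exact WithTop.coe_lt_coe.2 h1)
      refine (hout t ht h1.le hobs).trans_lt (lt_of_le_of_lt ?_ hx2)
      calc 2 * (‖stateOf (z 0)‖ * Real.exp (a * (N * τ)))
          ≤ 2 * (‖stateOf (z 0)‖ * Real.exp (a * (N * τ))) * Real.exp (K * s) :=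
            le_mul_of_one_le_right (by positivity) hexp1
        _ = ‖stateOf (z 0)‖ * A₀ := by
            rw [hA₀]
            ring
    · rcases le_or_gt t (T₀ + s) with h2 | h2
      · refine (hgrow t h1).trans_lt (lt_of_le_of_lt ?_ hx2)
        calc ‖z T₀‖ * Real.exp (K * (t - T₀))
            ≤ 2 * (‖stateOf (z 0)‖ * Real.exp (a * (N * τ))) * Real.exp (K * s) := by
              have h3 := hout T₀ hT₀0 le_rfl hobs0
              have h4 : t - T₀ ≤ s := by linarith
              gcongr
          _ = ‖stateOf (z 0)‖ * A₀ := by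
              rw [hA₀]
              ring
      · refine (hdecay t (by linarith)).trans_lt (lt_of_le_of_lt ?_ hs)
        rw [hinit]
        have h3 : outGain τ a j ≤ outGain τ a N := outGain_mono hτ0 ha0.le hjN.le
        have h4 : Real.exp (-rate * (t - T₀)) ≤ Real.exp (-rate * s) := by
          refine Real.exp_le_exp.2 (mul_le_mul_of_nonpos_left ?_ (neg_nonpos.2 hrate0.le))
          linarith
        have h5 := outGain_pos τ a j
        calc _ ≤ D * (G * outGain τ a N * Real.exp (Real.log (1 / Ω) + Real.log cb * N₀ / 2) *
              Real.exp (-rate * s)) := by gcongr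
          _ = E * Real.exp (-rate * s) := by
              simp only [E]
              ring

end Stabilization

/-! ### Extreme eigenvalues -/

section Eigenvalues

variable {κ : Type*} [Fintype κ] {A : Matrix κ κ ℝ}

theorem inner_act_nonneg (h : A.PosSemidef) (z : EuclideanSpace ℝ κ) :
    0 ≤ inner ℝ (act A z) z := by
  rw [inner_act_left]
  exact h.dotProduct_mulVec_nonneg z.ofLp

theorem inner_act_algebraMap [DecidableEq κ] (r : ℝ) (z : EuclideanSpace ℝ κ) :
    inner ℝ (act (algebraMap ℝ (Matrix κ κ ℝ) r) z) z = r * ‖z‖ ^ 2 := by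
  have h : act (algebraMap ℝ (Matrix κ κ ℝ) r) z = r • z := by
    rw [act, Algebra.algebraMap_eq_smul_one, Matrix.smul_mulVec, Matrix.one_mulVec]
    rfl
  rw [h, real_inner_smul_left, real_inner_self_eq_norm_sq]

theorem act_sub (A B : Matrix κ κ ℝ) (z : EuclideanSpace ℝ κ) :
    act (A - B) z = act A z - act B z := by
  simp [act, Matrix.sub_mulVec]

/-- Subtracting the smallest eigenvalue leaves a symmetric matrix with nonnegative spectrum. -/
theorem lamMin_mul_le [DecidableEq κ] (hA : A.IsHermitian) (z : EuclideanSpace ℝ κ) :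
    lamMin A * ‖z‖ ^ 2 ≤ inner ℝ (act A z) z := by
  have hpsd : (A - algebraMap ℝ (Matrix κ κ ℝ) (lamMin A)).PosSemidef := by
    rw [Matrix.posSemidef_iff_isHermitian_and_spectrum_nonneg]
    refine ⟨hA.sub (by simp [Algebra.algebraMap_eq_smul_one, Matrix.IsHermitian]), ?_⟩
    rw [← spectrum.sub_singleton_eq]
    rintro _ ⟨l, hl, _, rfl, rfl⟩
    exact sub_nonneg.2 (csInf_le Matrix.finite_real_spectrum.bddBelow hl)
  have := inner_act_nonneg hpsd z
  rw [act_sub, inner_sub_left, inner_act_algebraMap] at this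
  linarith

theorem inner_act_le_lamMax_mul [DecidableEq κ] (hA : A.IsHermitian) (z : EuclideanSpace ℝ κ) :
    inner ℝ (act A z) z ≤ lamMax A * ‖z‖ ^ 2 := by
  have hpsd : (algebraMap ℝ (Matrix κ κ ℝ) (lamMax A) - A).PosSemidef := by
    rw [Matrix.posSemidef_iff_isHermitian_and_spectrum_nonneg]
    refine ⟨Matrix.IsHermitian.sub
      (by simp [Algebra.algebraMap_eq_smul_one, Matrix.IsHermitian]) hA, ?_⟩
    rw [← spectrum.singleton_sub_eq]
    rintro _ ⟨_, rfl, l, hl, rfl⟩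
    exact sub_nonneg.2 (le_csSup Matrix.finite_real_spectrum.bddAbove hl)
  have := inner_act_nonneg hpsd z
  rw [act_sub, inner_sub_left, inner_act_algebraMap] at this
  linarith

/-- The finite spectrum attains its infimum. On an empty index type it would be `sInf ∅ = 0`. -/
theorem lamMin_pos [DecidableEq κ] [Nonempty κ] (hA : A.PosDef) : 0 < lamMin A := by
  have hne : (spectrum ℝ A).Nonempty :=
    ⟨_, hA.isHermitian.eigenvalues_mem_spectrum_real (Classical.arbitrary κ)⟩
  have hmem := hne.csInf_mem Matrix.finite_real_spectrum
  rw [hA.isHermitian.spectrum_real_eq_range_eigenvalues] at hmem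
  obtain ⟨j, hj⟩ := hmem
  rw [lamMin, hA.isHermitian.spectrum_real_eq_range_eigenvalues, ← hj]
  exact hA.eigenvalues_pos j

end Eigenvalues

/-! ### The concrete constants and the choice of parameters -/

section Constants

variable {ι : Type*} {n m p : ℕ} {sys : SwitchedSystem ι n m p}
  {q : EuclideanSpace ℝ (Fin p) → EuclideanSpace ℝ (Fin p)} {M Δ : ℝ}
  {P Q : ι → Matrix (Fin n ⊕ Fin n) (Fin n ⊕ Fin n) ℝ}

theorem transpose_eq_of_posDef {κ : Type*} {A : Matrix κ κ ℝ} (hA : A.PosDef) : Aᵀ = A := by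
  rw [← Matrix.conjTranspose_eq_transpose_of_trivial]
  exact hA.isHermitian

theorem inner_act_symm_of_posDef {κ : Type*} [Fintype κ] {A : Matrix κ κ ℝ} (hA : A.PosDef)
    (z w : EuclideanSpace ℝ κ) : inner ℝ (act A z) w = inner ℝ z (act A w) := by
  rw [inner_act_comm, transpose_eq_of_posDef hA]

theorem two_mul_inner_act_of_lyapunov {κ : Type*} [Fintype κ] {A B F : Matrix κ κ ℝ}
    (hA : A.PosDef) (h : Fᵀ * A + A * F = -B) (z : EuclideanSpace ℝ κ) :
    2 * inner ℝ (act A z) (act F z) = -inner ℝ (act B z) z := by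
  have h1 : inner ℝ (act (Fᵀ * A) z) z = inner ℝ (act A z) (act F z) := by
    rw [act_mul, inner_act_comm, Matrix.transpose_transpose]
  have h2 : inner ℝ (act (A * F) z) z = inner ℝ (act A z) (act F z) := by
    rw [act_mul, inner_act_symm_of_posDef hA, real_inner_comm]
  have h3 : act (Fᵀ * A) z + act (A * F) z = -act B z := by
    have : act (Fᵀ * A + A * F) z = act (-B) z := by rw [h]
    simpa [act, Matrix.add_mulVec, Matrix.neg_mulVec] using this
  rw [two_mul, ← inner_neg_left, ← h3, inner_add_left, h1, h2]

/-- The constants of the main theorem bound the Lyapunov functions and the outputs. -/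
theorem lyapunovBounds_of_posDef [Finite ι] [Nonempty ι] (hn : 0 < n)
    (hobs : ∀ i, IsObservable (sys.C i) (sys.A i)) (hP : ∀ i, (P i).PosDef)
    (hQ : ∀ i, (Q i).PosDef) (hPQ : ∀ i, (sys.F i)ᵀ * P i + P i * sys.F i = -Q i) {Θ : ℝ}
    (hΘ : 0 < Θ) (hΘ' : sys.Theta P Q ≤ Θ) :
    LyapunovBounds sys P Q (⨅ i, lamMin (P i)) (⨆ i, lamMax (P i)) (⨅ i, lamMin (Q i)) Θ
      sys.Cmax := by
  have : Nonempty (Fin n ⊕ Fin n) := ⟨Sum.inl ⟨0, hn⟩⟩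
  have hlP : 0 < ⨅ i, lamMin (P i) := by
    obtain ⟨i, hi⟩ := exists_eq_ciInf_of_finite (f := fun i => lamMin (P i))
    rw [← hi]
    exact lamMin_pos (hP i)
  have hlQ : 0 < ⨅ i, lamMin (Q i) := by
    obtain ⟨i, hi⟩ := exists_eq_ciInf_of_finite (f := fun i => lamMin (Q i))
    rw [← hi]
    exact lamMin_pos (hQ i)
  have hlow : ∀ i (z : ZSpace n),
      (⨅ i, lamMin (P i)) * ‖z‖ ^ 2 ≤ inner ℝ (act (P i) z) z := fun i z =>
    (mul_le_mul_of_nonneg_right (ciInf_le (finite_range _).bddBelow i) (sq_nonneg _)).trans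
      (lamMin_mul_le (hP i).isHermitian z)
  have hup : ∀ i (z : ZSpace n),
      inner ℝ (act (P i) z) z ≤ (⨆ i, lamMax (P i)) * ‖z‖ ^ 2 := fun i z =>
    (inner_act_le_lamMax_mul (hP i).isHermitian z).trans
      (mul_le_mul_of_nonneg_right
        (le_ciSup (f := fun i => lamMax (P i)) (finite_range _).bddAbove i) (sq_nonneg _))
  have hC : ∀ i, opNorm (sys.C i) ≤ sys.Cmax := fun i =>
    le_ciSup (f := fun i => opNorm (sys.C i)) (finite_range _).bddAbove i
  -- If all C_i vanished, no mode with n > 0 could be observable.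
  have hCmax : 0 < sys.Cmax := by
    by_contra! hle
    have i := Classical.arbitrary ι
    have h0 : ∀ v : EuclideanSpace ℝ (Fin n), act (sys.C i) v = 0 := fun v => by
      have h1 := norm_act_le (sys.C i) v
      have h2 : opNorm (sys.C i) * ‖v‖ ≤ 0 :=
        mul_nonpos_of_nonpos_of_nonneg ((hC i).trans hle) (norm_nonneg _)
      exact norm_le_zero_iff.1 (h1.trans h2)
    have h3 : (fun _ => 1 : Fin n → ℝ) = 0 := hobs i _ fun k _ => by
      have := h0 (act (sys.A i ^ k) (WithLp.toLp 2 fun _ => 1))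
      rw [← act_mul] at this
      exact congrArg WithLp.ofLp this
    exact one_ne_zero (congrFun h3 ⟨0, hn⟩)
  refine ⟨hlP, ?_, hlQ, hΘ, hCmax, fun i => inner_act_symm_of_posDef (hP i), hlow, hup, ?_,
    fun i => two_mul_inner_act_of_lyapunov (hP i) (hPQ i), fun i e => ?_, fun i z => ?_⟩
  · have i := Classical.arbitrary ι
    set z₁ : ZSpace n := EuclideanSpace.single (Sum.inl ⟨0, hn⟩) 1 with hz₁
    have hz : ‖z₁‖ = 1 := by simp [hz₁]
    have h1 := (hlow i z₁).trans (hup i z₁)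
    rw [hz] at h1
    linarith
  · exact fun i z => (mul_le_mul_of_nonneg_right (ciInf_le (finite_range _).bddBelow i)
      (sq_nonneg _)).trans (lamMin_mul_le (hQ i).isHermitian z)
  · rw [← act_mul]
    refine (norm_act_le _ _).trans (mul_le_mul_of_nonneg_right ?_ (norm_nonneg _))
    have h1 : opNorm (P i * sys.Lhat i) ≤ ⨆ i, opNorm (P i * sys.Lhat i) :=
      le_ciSup (f := fun i => opNorm (P i * sys.Lhat i)) (finite_range _).bddAbove i
    rw [SwitchedSystem.Theta, div_le_iff₀ hlQ] at hΘ'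
    linarith
  · exact (norm_act_le _ _).trans (mul_le_mul (hC i) (norm_stateOf_le z) (norm_nonneg _) hCmax.le)

/-- Without states or without modes, arbitrary constants are admissible. -/
theorem lyapunovBounds_of_trivial (h : n = 0 ∨ IsEmpty ι) {Θ : ℝ} (hΘ : 0 < Θ) :
    LyapunovBounds sys P Q 1 1 1 Θ 1 := by
  rcases h with rfl | h
  · have hz : ∀ z : ZSpace 0, z = 0 := fun z => Subsingleton.elim _ _
    refine ⟨one_pos, one_pos, one_pos, hΘ, one_pos, fun i z w => ?_, fun i z => ?_, fun i z => ?_,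
      fun i z => ?_, fun i z => ?_, fun i e => ?_, fun i z => ?_⟩
    · rw [hz z, hz w, inner_zero_right, inner_zero_left]
    · rw [hz z, inner_zero_right, norm_zero]
      simp
    · rw [hz z, inner_zero_right, norm_zero]
      simp
    · rw [hz z, inner_zero_right, norm_zero]
      simp
    · rw [hz z, hz (act (sys.F i) 0), inner_zero_right, inner_zero_right]
      simp
    · rw [hz (act (P i) _), norm_zero]
      positivity
    · have h0 : stateOf z = 0 := Subsingleton.elim _ _
      rw [SwitchedSystem.output, h0, act_eq_actL, map_zero, norm_zero]
      positivity
  · exact ⟨one_pos, one_pos, one_pos, hΘ, one_pos, fun i => h.elim i, fun i => h.elim i,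
      fun i => h.elim i, fun i => h.elim i, fun i => h.elim i, fun i => h.elim i, fun i => h.elim i⟩

variable {lP LP lQ Θ Cm : ℝ}

/-- Large average dwell times suffice. -/
theorem LyapunovBounds.exists_stabilizes [Finite ι] (hb : LyapunovBounds sys P Q lP LP lQ Θ Cm)
    (hobs : ∀ i, IsObservable (sys.C i) (sys.A i)) (hq : IsQuantizer q M Δ)
    (hM : √(LP / lP) * Θ * Δ * Cm < M) :
    ∃ τmin : ℝ, 0 ≤ τmin ∧ ∀ τa > τmin, ∃ (Ω T : ℝ) (c : ι → ι → ℝ),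
      0 < Ω ∧ Ω < 1 ∧ 0 < T ∧ (∀ i j, i ≠ j → 0 < c j i) ∧ Stabilizes sys q Ω T c τa := by
  have hlP := hb.lP_pos
  have hLP := hb.LP_pos
  have hΘ := hb.Θ_pos
  have hCm := hb.Cm_pos
  have hΔ := hq.pos
  have hM0 : 0 < M := hΔ.trans hq.lt
  set b : ℝ := √(LP / lP) * Θ * Δ * Cm with hbdef
  have hb0 : 0 < b := by positivity
  -- This κ places b(1 + κ) halfway between b and M.
  set κ : ℝ := (M / b - 1) / 2 with hκdef
  have hκ : 0 < κ := by
    have : 1 < M / b := by rwa [one_lt_div hb0]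
    linarith
  have hbκ : b * (1 + κ) = (b + M) / 2 := by
    rw [hκdef]
    field_simp
    ring
  set Ω : ℝ := b * (1 + κ) / M with hΩdef
  have hΩ0 : 0 < Ω := by positivity
  have hΩ1 : Ω < 1 := by
    rw [hΩdef, div_lt_one hM0, hbκ]
    linarith
  have hΩ : Ω ^ 2 = LP / lP * (Θ * Δ * (1 + κ) * Cm / M) ^ 2 := by
    have : Ω = √(LP / lP) * (Θ * Δ * (1 + κ) * Cm / M) := by
      rw [hΩdef, hbdef]
      ring
    rw [this, mul_pow, Real.sq_sqrt (by positivity)]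
  set T : ℝ := max 1 ((lP * M ^ 2 - LP * (Θ * Δ * (1 + κ) * Cm) ^ 2) /
      (lQ * κ * (1 + κ) * (Θ * Δ * Cm) ^ 2)) + 1 with hTdef
  have hT1 : 0 < T := by positivity
  have hT : (lP * M ^ 2 - LP * (Θ * Δ * (1 + κ) * Cm) ^ 2) /
      (lQ * κ * (1 + κ) * (Θ * Δ * Cm) ^ 2) < T :=
    lt_of_le_of_lt (le_max_right 1 _) (lt_add_one _)
  -- The constant jump factor λ̄_P/λ̲_P compares any two modes. The maximum with 1 is needed because
  -- the abstract bounds do not force LP ≥ lP when n = 0 or there are no modes.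
  refine ⟨max 0 (Real.log (max 1 (LP / lP)) / (2 * Real.log (1 / Ω)) * T), le_max_left _ _,
    fun τa hτa => ⟨Ω, T, fun _ _ => LP / lP, hΩ0, hΩ1, hT1, fun _ _ _ => by positivity, ?_⟩⟩
  refine hb.stabilizes hobs hq hκ hΩ0 hΩ1 hT1 hΩ hT (fun _ _ _ => by positivity)
    (fun i j _ z => ?_) (fun _ _ _ => le_max_right _ _) (le_max_left _ _)
    ((le_max_left _ _).trans_lt hτa) ((le_max_right _ _).trans_lt hτa)
  calc inner ℝ (act (P j) z) z ≤ LP * ‖z‖ ^ 2 := hb.P_upper j z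
    _ = LP / lP * (lP * ‖z‖ ^ 2) := by field_simp
    _ ≤ LP / lP * inner ℝ (act (P i) z) z := by
        have := hb.P_lower i z
        gcongr

end Constants

/-- The largest jump factor is at least `1`, unless there is only one mode. -/
theorem exists_bound_jumpFactors {ι : Type*} [Finite ι] {n : ℕ} (hn : 0 < n)
    {P : ι → Matrix (Fin n ⊕ Fin n) (Fin n ⊕ Fin n) ℝ} (hP : ∀ i, (P i).PosDef) {c : ι → ι → ℝ}
    (hc : ∀ i j, i ≠ j → 0 < c j i ∧
      ∀ v : Fin n ⊕ Fin n → ℝ, v ⬝ᵥ (P j *ᵥ v) ≤ c j i * (v ⬝ᵥ (P i *ᵥ v))) :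
    ∃ cb : ℝ, 1 ≤ cb ∧ (∀ i j, i ≠ j → c j i ≤ cb) ∧
      Real.log cb = Real.log (⨆ e : {e : ι × ι // e.1 ≠ e.2}, c e.1.1 e.1.2) := by
  set f : {e : ι × ι // e.1 ≠ e.2} → ℝ := fun e => c e.1.1 e.1.2
  have hle : ∀ i j, i ≠ j → c j i ≤ ⨆ e, f e := fun i j hij =>
    le_ciSup (f := f) (finite_range _).bddAbove ⟨(j, i), hij.symm⟩
  by_cases hne : ∃ i j : ι, i ≠ j
  · obtain ⟨i, j, hij⟩ := hne
    refine ⟨⨆ e, f e, ?_, hle, rfl⟩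
    set v : Fin n ⊕ Fin n → ℝ := fun _ => 1 with hv
    have hv0 : v ≠ 0 := fun h => one_ne_zero (congrFun h (Sum.inl ⟨0, hn⟩))
    have hpos : 0 < v ⬝ᵥ (P j *ᵥ v) := (hP j).dotProduct_mulVec_pos hv0
    obtain ⟨c1, h1⟩ := hc i j hij
    obtain ⟨c2, h2⟩ := hc j i hij.symm
    have h3 : v ⬝ᵥ (P j *ᵥ v) ≤ c j i * c i j * (v ⬝ᵥ (P j *ᵥ v)) := by
      rw [mul_assoc]
      exact (h1 v).trans (mul_le_mul_of_nonneg_left (h2 v) c1.le)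
    have h4 : 1 ≤ c j i * c i j := by
      by_contra! hlt
      nlinarith
    -- Going from j to i and back shows c_{j,i}c_{i,j} ≥ 1, so the largest factor is at least 1.
    have h5 : c j i * c i j ≤ (⨆ e, f e) ^ 2 := by
      rw [sq]
      exact mul_le_mul (hle i j hij) (hle j i hij.symm) c2.le (c1.le.trans (hle i j hij))
    exact (one_le_sq_iff₀ (c1.le.trans (hle i j hij))).1 (h4.trans h5)
  · push Not at hne
    have : IsEmpty {e : ι × ι // e.1 ≠ e.2} := ⟨fun e => e.2 (hne _ _)⟩
    -- With a single mode the supremum is over the empty set, hence 0, and `Real.log 0 = 0 =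
    -- Real.log 1`.
    refine ⟨1, le_rfl, fun i j hij => absurd (hne i j) hij, ?_⟩
    rw [Real.iSup_of_isEmpty, Real.log_one, Real.log_zero]

end QuantizedSwitching

end

/-! ### The main theorem -/

open QuantizedSwitching in
theorem theorem1 {ι : Type*} [Finite ι] {n m p : ℕ} (sys : SwitchedSystem ι n m p)
    (hstab : ∀ i, IsStabilizable (sys.A i) (sys.B i))
    (hobs : ∀ i, IsObservable (sys.C i) (sys.A i))
    (hK : ∀ i, IsHurwitz (sys.A i + sys.B i * sys.K i))
    (hL : ∀ i, IsHurwitz (sys.A i + sys.L i * sys.C i))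
    (P Q : ι → Matrix (Fin n ⊕ Fin n) (Fin n ⊕ Fin n) ℝ)
    (hP : ∀ i, (P i).PosDef) (hQ : ∀ i, (Q i).PosDef)
    (hPQ : ∀ i, (sys.F i)ᵀ * P i + P i * sys.F i = -Q i)
    (q : EuclideanSpace ℝ (Fin p) → EuclideanSpace ℝ (Fin p)) (M Δ : ℝ)
    (hq : IsQuantizer q M Δ)
    (lamPmax lamPmin lamQmin Θ Cmax : ℝ)
    (hlamPmax : lamPmax = ⨆ i, lamMax (P i)) (hlamPmin : lamPmin = ⨅ i, lamMin (P i))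
    (hlamQmin : lamQmin = ⨅ i, lamMin (Q i)) (hΘ : Θ = sys.Theta P Q) (hCmax : Cmax = sys.Cmax)
    (hM : M > max (2 * Δ) (√(lamPmax / lamPmin) * Θ * Δ * Cmax)) :
    -- a sufficiently large average dwell time suffices
    (∃ τmin : ℝ, 0 ≤ τmin ∧ ∀ τa > τmin, ∃ (Ω T : ℝ) (c : ι → ι → ℝ),
      0 < Ω ∧ Ω < 1 ∧ 0 < T ∧ (∀ i j, i ≠ j → 0 < c j i) ∧ Stabilizes sys q Ω T c τa) ∧
    -- the explicit bound and the explicit zooming-in law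
    (0 < Θ → ∀ (κ T Ω : ℝ) (c : ι → ι → ℝ) (τa : ℝ), 0 < κ →
      √lamPmin * M > √lamPmax * Θ * Δ * (1 + κ) * Cmax →
      T > (lamPmin * M ^ 2 - lamPmax * (Θ * Δ * (1 + κ) * Cmax) ^ 2) /
        (lamQmin * κ * (1 + κ) * (Θ * Δ * Cmax) ^ 2) →
      Ω = √(lamPmax / lamPmin) * (Θ * Δ * (1 + κ) * Cmax / M) →
      (∀ i j, i ≠ j → 0 < c j i ∧
        ∀ v : Fin n ⊕ Fin n → ℝ, v ⬝ᵥ (P j *ᵥ v) ≤ c j i * (v ⬝ᵥ (P i *ᵥ v))) →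
      0 < τa →
      τa > Real.log (⨆ e : {e : ι × ι // e.1 ≠ e.2}, c e.1.1 e.1.2) / (2 * Real.log (1 / Ω)) * T →
      Stabilizes sys q Ω T c τa) := by
  have hΔ := hq.pos
  have hM0 : 0 < M := hΔ.trans hq.lt
  have hM' : √(lamPmax / lamPmin) * Θ * Δ * Cmax < M := (le_max_right _ _).trans_lt hM
  by_cases htriv : n = 0 ∨ IsEmpty ι
  · refine ⟨?_, fun hpos => ?_⟩
    -- With all other constants equal to 1, this choice makes the product in the range condition
    -- M/2.
    · have hb : LyapunovBounds sys P Q 1 1 1 (M / (2 * Δ)) 1 :=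
        lyapunovBounds_of_trivial htriv (by positivity)
      refine hb.exists_stabilizes hobs hq ?_
      rw [div_one, Real.sqrt_one, one_mul, mul_one]
      have : M / (2 * Δ) * Δ = M / 2 := by field_simp
      rw [this]
      linarith
    -- Here Θ = 0 by default values: a division by 0 if n = 0, an empty supremum if there are no
    -- modes.
    · exfalso
      refine hpos.ne' ?_
      rw [hΘ, SwitchedSystem.Theta]
      rcases htriv with rfl | h
      · have : ∀ i, lamMin (Q i) = 0 := fun i => by
          rw [lamMin, Set.eq_empty_of_forall_notMem (s := spectrum ℝ (Q i)) fun l hl => ?_]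
          · exact Real.sInf_empty
          · exact hl (isUnit_of_subsingleton _)
        simp [this]
      · simp
  · push Not at htriv
    obtain ⟨hn, hne⟩ := htriv
    have hn' : 0 < n := Nat.pos_of_ne_zero hn
    have hbounds : ∀ Θ', 0 < Θ' → Θ ≤ Θ' →
        LyapunovBounds sys P Q lamPmin lamPmax lamQmin Θ' Cmax := fun Θ' h0 hle => by
      rw [hlamPmax, hlamPmin, hlamQmin, hCmax]
      exact lyapunovBounds_of_posDef hn' hobs hP hQ hPQ h0 (hΘ ▸ hle)
    refine ⟨?_, ?_⟩
    · have hb₁ := hbounds (max Θ 1) (lt_max_of_lt_right one_pos) (le_max_left _ _)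
      have hCm := hb₁.Cm_pos
      have hΘ0 : 0 ≤ Θ := by
        rw [hΘ, SwitchedSystem.Theta, ← hlamQmin]
        exact div_nonneg (mul_nonneg two_pos.le (Real.iSup_nonneg fun i => opNorm_nonneg _))
          hb₁.lQ_pos.le
      -- Θ may be 0, whereas the bounds need a positive constant. The range condition is strict, so
      -- Θ can be enlarged slightly.
      obtain ⟨Θ', h1, h2⟩ : ∃ Θ', √(lamPmax / lamPmin) * Θ' * Δ * Cmax < M ∧ Θ < Θ' := by
        have hcont : Continuous fun x : ℝ => √(lamPmax / lamPmin) * x * Δ * Cmax := by fun_prop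
        have hev : ∀ᶠ x in 𝓝[>] Θ, √(lamPmax / lamPmin) * x * Δ * Cmax < M :=
          ((hcont.tendsto Θ).mono_left nhdsWithin_le_nhds).eventually_lt_const hM'
        exact (hev.and self_mem_nhdsWithin).exists
      exact (hbounds Θ' (hΘ0.trans_lt h2) h2.le).exists_stabilizes hobs hq h1
    · intro hΘ0 κ T Ω c τa hκ hκM hT hΩ hc hτa hτ
      have hb := hbounds Θ hΘ0 le_rfl
      have hlP := hb.lP_pos
      have hLP := hb.LP_pos
      have hlQ := hb.lQ_pos
      have hCm := hb.Cm_pos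
      have hΩ0 : 0 < Ω := by
        rw [hΩ]
        positivity
      have hΩ2 : Ω ^ 2 = lamPmax / lamPmin * (Θ * Δ * (1 + κ) * Cmax / M) ^ 2 := by
        rw [hΩ, mul_pow, Real.sq_sqrt (by positivity)]
      have hsq : lamPmax * (Θ * Δ * (1 + κ) * Cmax) ^ 2 < lamPmin * M ^ 2 := by
        have h1 := pow_lt_pow_left₀ hκM (by positivity) two_ne_zero
        have h2 : (√lamPmax * Θ * Δ * (1 + κ) * Cmax) ^ 2 =
            lamPmax * (Θ * Δ * (1 + κ) * Cmax) ^ 2 := by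
          calc _ = √lamPmax ^ 2 * (Θ * Δ * (1 + κ) * Cmax) ^ 2 := by ring
            _ = _ := by rw [Real.sq_sqrt hLP.le]
        rwa [h2, mul_pow (√lamPmin), Real.sq_sqrt hlP.le] at h1
      have hΩ1 : Ω < 1 := by
        refine lt_of_pow_lt_pow_left₀ 2 one_pos.le ?_
        rw [hΩ2, one_pow, div_pow, div_mul_div_comm, div_lt_one (by positivity)]
        exact hsq
      have hT0 : 0 < T := lt_trans (div_pos (sub_pos.2 hsq) (by positivity)) hT
      obtain ⟨cb, hcb1, hcb, hlog⟩ := exists_bound_jumpFactors hn' hP hc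
      refine hb.stabilizes hobs hq hκ hΩ0 hΩ1 hT0 hΩ2 hT (fun i j hij => (hc i j hij).1)
        (fun i j hij z => ?_) hcb hcb1 hτa (by rw [hlog]; exact hτ)
      rw [inner_act_left, inner_act_left]
      exact (hc i j hij).2 z.ofLp
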